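/- Let $d\ge 1$, let $\Omega\subset\mathbb{R}^d$ be open and bounded with boundary $\Gamma=\partial\Omega$, let $\sigma=\mathcal{H}^{d-1}$ be the $(d-1)$-dimensional Hausdorff measure, and assume $\sigma(\Gamma)<\infty$. Write $L^2(\Gamma)=L^2(\Gamma,\sigma)$ and let $\beta\in L^\infty(\Gamma)$ be complex-valued. For $u\in H^1(\Omega)$ let $\operatorname{Tr}(u)$ be the set of all $\varphi\in L^2(\Gamma)$ for which there is a sequence $(u_n)$ in $C(\overline\Omega)\cap H^1(\Omega)$ with $u_n\to u$ in $H^1(\Omega)$ and $u_n|_\Gamma\to\varphi$ in $L^2(\Gamma)$. For $u\in H^1(\Omega)$ with $\Delta u\in L^2(\Omega)$ (in the sense of distributions) and $h\in L^2(\Gamma)$, write $\partial_\nu u=h$ if \[ \int_\Omega(\Delta u)\overline v+\int_\Omega\nabla u\cdot\overline{\nabla v}=\int_\Gamma h\overline v\,d\sigma\qquad\text{for all } v\in C(\overline\Omega)\cap H^1(\Omega), \] and $\partial_\nu u\in L^2(\Gamma)$ if such an $h$ exists. Define the Wentzell Laplacian $\Delta^{W}$ in $L^2(\Omega)\oplus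 L^2(\Gamma)$ by \[ D(\Delta^{W})=\{(u,\varphi)\in H^1(\Omega)\oplus L^2(\Gamma):\ \Delta u\in L^2(\Omega),\ \varphi\in\operatorname{Tr}(u),\ \partial_\nu u\in L^2(\Gamma)\}, \] \[ \Delta^{W}(u,\varphi)=(\Delta u,\,-\partial_\nu u-\beta\varphi). \] Then there exists $\omega_0\ge 0$ such that $\Delta^{W}-\omega_0$ generates a $C_0$-semigroup $(S(t))_{t\ge0}$ on $L^2(\Omega)\oplus L^2(\Gamma)$, and this semigroup is $L^\infty$-contractive: for all $f\in L^\infty(\Omega)\oplus L^\infty(\Gamma)$ and all $t>0$, \[ \|S(t)f\|_\infty\le\|f\|_\infty,\qquad\text{where } \|(u,\varphi)\|_\infty=\max\{\|u\|_{L^\infty(\Omega)},\|\varphi\|_{L^\infty(\Gamma)}\}. \] -/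

import Mathlib

open MeasureTheory Filter Topology
open scoped ENNReal NNReal ComplexConjugate

noncomputable section

namespace Wentzell

/-! ### Strongly continuous semigroups -/

section Semigroup

variable {H : Type*} [NormedAddCommGroup H] [NormedSpace ℂ H]

/-- `(S t)_{t ≥ 0}` is a `C₀`-semigroup of bounded operators on `H`. -/
structure IsC0Semigroup (S : ℝ≥0 → H →L[ℂ] H) : Prop where
  map_zero : S 0 = ContinuousLinearMap.id ℂ H
  map_add : ∀ s t : ℝ≥0, S (s + t) = (S s).comp (S t)
  strong_continuity : ∀ x : H, Tendsto (fun t : ℝ≥0 => S t x) (𝓝[>] 0) (𝓝 x)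

/-- An (unbounded) operator `A` is given by its graph: `A x y` means `x ∈ D(A)` and `A x = y`.
`Generates A S` says that `S` is a `C₀`-semigroup and that its infinitesimal generator, whose
domain consists of all `x` for which `lim_{t ↓ 0} (S t x - x) / t` exists, is exactly `A`.
In particular it forces the relation `A` to be single-valued. -/
def Generates (A : H → H → Prop) (S : ℝ≥0 → H →L[ℂ] H) : Prop :=
  IsC0Semigroup S ∧
    ∀ x y : H, A x y ↔
      Tendsto (fun t : ℝ≥0 => (((t : ℝ) : ℂ)⁻¹) • (S t x - x)) (𝓝[>] 0) (𝓝 y)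

/-- The graph of `A - ω`: one has `(A - ω) x = y` if and only if `A x = y + ω x`. -/
def subScalar (A : H → H → Prop) (ω : ℝ) : H → H → Prop :=
  fun x y => A x (y + (ω : ℂ) • x)

end Semigroup

/-! ### Function spaces on `Ω` and on its boundary -/

variable {d : ℕ}

/-- Lebesgue measure on `Ω`. -/
abbrev volOn (Ω : Set (EuclideanSpace ℝ (Fin d))) : Measure (EuclideanSpace ℝ (Fin d)) :=
  volume.restrict Ω

/-- The `(d - 1)`-dimensional Hausdorff measure (normalised so as to agree with Lebesgue measure
on `(d - 1)`-dimensional Euclidean space) on the boundary `Γ = ∂Ω`. -/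
abbrev surfOn (Ω : Set (EuclideanSpace ℝ (Fin d))) : Measure (EuclideanSpace ℝ (Fin d)) :=
  (Measure.euclideanHausdorffMeasure (d - 1)).restrict (frontier Ω)

/-- The Hilbert space `L²(Ω) ⊕ L²(Γ)`. -/
abbrev L2Sum (Ω : Set (EuclideanSpace ℝ (Fin d))) : Type :=
  WithLp 2 (Lp ℂ 2 (volOn Ω) × Lp ℂ 2 (surfOn Ω))

/-- `φ ∈ C_c^∞(Ω)`, complex-valued. -/
structure IsTestFunction (Ω : Set (EuclideanSpace ℝ (Fin d)))
    (φ : EuclideanSpace ℝ (Fin d) → ℂ) : Prop where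
  contDiff : ContDiff ℝ ((⊤ : ℕ∞) : WithTop ℕ∞) φ
  hasCompactSupport : HasCompactSupport φ
  tsupport_subset : tsupport φ ⊆ Ω

/-- `u ∈ H¹(Ω)` with weak gradient `∇u = g`. -/
structure HasH1Gradient (Ω : Set (EuclideanSpace ℝ (Fin d)))
    (u : EuclideanSpace ℝ (Fin d) → ℂ)
    (g : EuclideanSpace ℝ (Fin d) → EuclideanSpace ℂ (Fin d)) : Prop where
  memLp : MemLp u 2 (volOn Ω)
  memLp_grad : MemLp g 2 (volOn Ω)
  weak : ∀ φ : EuclideanSpace ℝ (Fin d) → ℂ, IsTestFunction Ω φ → ∀ i : Fin d,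
    ∫ x in Ω, u x * fderiv ℝ φ x (EuclideanSpace.single i 1) = - ∫ x in Ω, g x i * φ x

/-- `Δu = f` in the sense of distributions on `Ω`, where `f ∈ L²(Ω)`. -/
structure HasL2Laplacian (Ω : Set (EuclideanSpace ℝ (Fin d)))
    (u f : EuclideanSpace ℝ (Fin d) → ℂ) : Prop where
  memLp : MemLp f 2 (volOn Ω)
  weak : ∀ φ : EuclideanSpace ℝ (Fin d) → ℂ, IsTestFunction Ω φ →
    ∫ x in Ω, u x * Laplacian.laplacian φ x = ∫ x in Ω, f x * φ x

/-- `ψ ∈ L²(Γ)` is an approximative trace of `u ∈ H¹(Ω)`: there are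
`uₙ ∈ C(closure Ω) ∩ H¹(Ω)` with `uₙ → u` in `H¹(Ω)` and `uₙ|_Γ → ψ` in `L²(Γ)`. -/
def IsTrace (Ω : Set (EuclideanSpace ℝ (Fin d)))
    (u ψ : EuclideanSpace ℝ (Fin d) → ℂ) : Prop :=
  MemLp ψ 2 (surfOn Ω) ∧
  ∃ g, HasH1Gradient Ω u g ∧
  ∃ (un : ℕ → EuclideanSpace ℝ (Fin d) → ℂ)
    (gn : ℕ → EuclideanSpace ℝ (Fin d) → EuclideanSpace ℂ (Fin d)),
    (∀ n, ContinuousOn (un n) (closure Ω)) ∧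
    (∀ n, HasH1Gradient Ω (un n) (gn n)) ∧
    Tendsto (fun n => eLpNorm (un n - u) 2 (volOn Ω)) atTop (𝓝 0) ∧
    Tendsto (fun n => eLpNorm (gn n - g) 2 (volOn Ω)) atTop (𝓝 0) ∧
    Tendsto (fun n => eLpNorm (un n - ψ) 2 (surfOn Ω)) atTop (𝓝 0)

/-- `u ∈ H¹(Ω)`, `Δu ∈ L²(Ω)` and `∂_ν u = h ∈ L²(Γ)`, defined through Green's formula
`∫_Ω (Δu) v̄ + ∫_Ω ∇u · ∇v̄ = ∫_Γ h v̄` for all `v ∈ C(closure Ω) ∩ H¹(Ω)`. -/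
def HasNormalDeriv (Ω : Set (EuclideanSpace ℝ (Fin d)))
    (u h : EuclideanSpace ℝ (Fin d) → ℂ) : Prop :=
  MemLp h 2 (surfOn Ω) ∧
  ∃ g f, HasH1Gradient Ω u g ∧ HasL2Laplacian Ω u f ∧
    ∀ v gv, ContinuousOn v (closure Ω) → HasH1Gradient Ω v gv →
      (∫ x in Ω, f x * conj (v x)) + ∫ x in Ω, ∑ i : Fin d, g x i * starRingEnd ℂ (gv x i)
        = ∫ x, h x * conj (v x) ∂(surfOn Ω)

/-- The graph of the Wentzell Laplacian `Δ^W` in `L²(Ω) ⊕ L²(Γ)`: `p = (u, ψ)` lies in the domain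
if `u ∈ H¹(Ω)`, `Δu ∈ L²(Ω)`, `ψ ∈ Tr(u)` and `∂_ν u ∈ L²(Γ)`, and then
`q = (Δu, -∂_ν u - β ψ)`. -/
def wentzellLaplacian (Ω : Set (EuclideanSpace ℝ (Fin d)))
    (β : EuclideanSpace ℝ (Fin d) → ℂ) (p q : L2Sum Ω) : Prop :=
  (∃ g, HasH1Gradient Ω p.fst g) ∧
  HasL2Laplacian Ω p.fst q.fst ∧
  IsTrace Ω p.fst p.snd ∧
  ∃ h, HasNormalDeriv Ω p.fst h ∧
    ∀ᵐ x ∂(surfOn Ω), q.snd x = - h x - β x * p.snd x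

/-- The norm of `L^∞(Ω ⊔ Γ) = L^∞(Ω) ⊕ L^∞(Γ)`, equal to `∞` for elements of `L²(Ω) ⊕ L²(Γ)`
that are not essentially bounded. -/
def linftyNorm (Ω : Set (EuclideanSpace ℝ (Fin d))) (p : L2Sum Ω) : ℝ≥0∞ :=
  max (eLpNorm p.fst ∞ (volOn Ω)) (eLpNorm p.snd ∞ (surfOn Ω))

/-- `‖S(t) p‖_∞ ≤ ‖p‖_∞` for all `p ∈ L^∞(Ω) ⊕ L^∞(Γ)` and `t > 0`; as `Ω ⊔ Γ` has finite measure,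
`L^∞(Ω) ⊕ L^∞(Γ)` consists of the `p ∈ L²(Ω) ⊕ L²(Γ)` with `‖p‖_∞ < ∞`. -/
def IsLinftyContractive (Ω : Set (EuclideanSpace ℝ (Fin d)))
    (S : ℝ≥0 → L2Sum Ω →L[ℂ] L2Sum Ω) : Prop :=
  ∀ t : ℝ≥0, 0 < t → ∀ p : L2Sum Ω, linftyNorm Ω p < ∞ →
    linftyNorm Ω (S t p) ≤ linftyNorm Ω p

end Wentzell

end

/-! Put ω₀ = ‖β‖_∞. The shifted operator Δ^W - ω₀ is minus the operator of the form ∫_Ω ∇u·∇v̄ + ω₀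
∫_Ω u v̄ + ∫_Γ (ω₀ + β) φ ψ̄, whose real part is nonnegative because Re(ω₀ + β) ≥ 0 on Γ. A function
u may have several approximative traces φ, so the form lives on pairs (u, φ). Its domain is obtained
by closing the triples (v, v|_Γ, ∇v), with v continuous on the closure of Ω and in H¹, in L²(Ω) ⊕
L²(Γ) ⊕ L²(Ω; ℂᵈ). Green's formula, tested on these triples, is exactly the equation defining the
operator of the form (`wentzellLaplacian_iff_formRel`).

Generation: Lax–Milgram on the closed form domain solves p - h A p = f, and the restrictions of
smooth functions are dense in L²(Ω) ⊕ L²(Γ), which makes A single-valued. Hence A is m-dissipative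
(`formRel_isMDissipative`, `formRel_zero_eq_zero`), and the Yosida approximations produce a
contraction semigroup with generator exactly A (`IsMDissipative.generates`).

L^∞-contractivity: a closed set invariant under all resolvents is invariant under every C₀-semigroup
generated by A (`IsMDissipative.mapsTo_of_resolvent`), so it suffices to treat p - h A p = f with
‖f‖_∞ ≤ M. Test this equation with E(p), where E is a C¹ radial map vanishing exactly on the disc of
radius M. The form is accretive against E(p), so Re⟨E(p), p - f⟩ ≤ 0. The integrand is pointwise
nonnegative, and positive where |p| > M, so |p| ≤ M almost everywhere on Ω and on Γ. Smoothness of E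
means that only the C¹ chain rule for continuous H¹ functions is needed, and this follows by
mollification. -/

noncomputable section

namespace Wentzell

/-! ### Exponentials of bounded dissipative operators -/

section BoundedGenerators

variable {H : Type*} [NormedAddCommGroup H] [InnerProductSpace ℂ H] [CompleteSpace H]

/-- The uniformly continuous group generated by a bounded operator. -/
def expOp (B : H →L[ℂ] H) (t : ℝ) : H →L[ℂ] H := NormedSpace.exp ((t : ℂ) • B)

lemma expOp_zero (B : H →L[ℂ] H) : expOp B 0 = 1 := by
  simp [expOp]

lemma expOp_add (B : H →L[ℂ] H) (s t : ℝ) : expOp B (s + t) = expOp B s * expOp B t := by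
  let _ : NormedAlgebra ℚ (H →L[ℂ] H) := NormedAlgebra.restrictScalars ℚ ℂ _
  unfold expOp
  rw [← NormedSpace.exp_add_of_commute, ← add_smul, Complex.ofReal_add]
  exact ((Commute.refl B).smul_left _).smul_right _

lemma commute_expOp {B C : H →L[ℂ] H} (h : Commute C B) (t : ℝ) : Commute C (expOp B t) :=
  (h.smul_right _).exp_right

lemma hasDerivAt_expOp (B : H →L[ℂ] H) (t : ℝ) :
    HasDerivAt (expOp B) (expOp B t * B) t := by
  have h := (hasDerivAt_exp_smul_const (𝕂 := ℂ) B (t : ℂ)).scomp t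
    (Complex.ofRealCLM.hasDerivAt (x := t))
  rw [show Complex.ofRealCLM 1 = 1 by simp, one_smul] at h
  exact h

lemma hasDerivAt_expOp_apply (B : H →L[ℂ] H) (x : H) (t : ℝ) :
    HasDerivAt (fun s => expOp B s x) (expOp B t (B x)) t := by
  have h := (((ContinuousLinearMap.apply ℂ H x).restrictScalars ℝ).hasFDerivAt
    (x := expOp B t)).comp_hasDerivAt t (hasDerivAt_expOp B t)
  simpa [Function.comp_def] using h

/-- The derivative of ‖exp(sB)x‖² is 2 Re⟨B exp(sB)x, exp(sB)x⟩ ≤ 0. -/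
lemma norm_expOp_apply_le {B : H →L[ℂ] H} (hB : ∀ x, RCLike.re (inner ℂ (B x) x) ≤ 0)
    {t : ℝ} (ht : 0 ≤ t) (x : H) : ‖expOp B t x‖ ≤ ‖x‖ := by
  let _ : InnerProductSpace ℝ H := InnerProductSpace.rclikeToReal ℂ H
  have hcomm : ∀ s, expOp B s (B x) = B (expOp B s x) := fun s =>
    (DFunLike.congr_fun (commute_expOp (Commute.refl B) s).eq x).symm
  have hd : ∀ s : ℝ, HasDerivAt (fun s => ‖expOp B s x‖ ^ 2)
      (2 * RCLike.re (inner ℂ (expOp B s x) (B (expOp B s x)))) s := by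
    intro s
    have := (hasDerivAt_expOp_apply B x s).norm_sq
    rw [hcomm] at this
    exact this
  have hanti : Antitone (fun s => ‖expOp B s x‖ ^ 2) := by
    refine antitone_of_deriv_nonpos (fun s => (hd s).differentiableAt) fun s => ?_
    rw [(hd s).deriv]
    have := hB (expOp B s x)
    rw [← inner_conj_symm, RCLike.conj_re] at this
    linarith
  have h0 := hanti ht
  simp only [expOp_zero, one_apply_eq_self] at h0
  exact (sq_le_sq₀ (norm_nonneg _) (norm_nonneg _)).1 h0

/-- The curve s ↦ exp(sB) exp((t - s)C)x joins exp(tC)x to exp(tB)x. Since B and C commute, its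
velocity is exp(sB) exp((t - s)C)(B - C)x, which contractivity bounds by ‖(B - C)x‖. -/
lemma norm_expOp_sub_le {B C : H →L[ℂ] H} (hB : ∀ x, RCLike.re (inner ℂ (B x) x) ≤ 0)
    (hC : ∀ x, RCLike.re (inner ℂ (C x) x) ≤ 0) (hBC : Commute B C)
    {t : ℝ} (ht : 0 ≤ t) (x : H) :
    ‖expOp B t x - expOp C t x‖ ≤ t * ‖B x - C x‖ := by
  have hd : ∀ s : ℝ, HasDerivAt (fun s => expOp B s * expOp C (t - s))
      (expOp B s * expOp C (t - s) * (B - C)) s := by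
    intro s
    have h1 := hasDerivAt_expOp B s
    have h2 : HasDerivAt (fun s => expOp C (t - s)) (-(expOp C (t - s) * C)) s := by
      simpa [Function.comp_def] using
        (hasDerivAt_expOp C (t - s)).scomp s ((hasDerivAt_id s).const_sub t)
    have h3 := h1.mul h2
    have e : expOp B s * expOp C (t - s) * (B - C) =
        expOp B s * B * expOp C (t - s) + expOp B s * -(expOp C (t - s) * C) := by
      rw [mul_assoc, mul_sub, ← (commute_expOp hBC (t - s)).eq, mul_assoc, mul_sub, mul_neg,
        sub_eq_add_neg]
    rw [e]
    exact h3
  have hd' : ∀ s : ℝ, HasDerivAt (fun s => expOp B s (expOp C (t - s) x))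
      (expOp B s (expOp C (t - s) (B x - C x))) s := by
    intro s
    have h := (((ContinuousLinearMap.apply ℂ H x).restrictScalars ℝ).hasFDerivAt
      (x := expOp B s * expOp C (t - s))).comp_hasDerivAt s (hd s)
    simpa [Function.comp_def] using h
  have := norm_image_sub_le_of_norm_deriv_le_segment' (a := 0) (b := t)
    (fun s _ => (hd' s).hasDerivWithinAt) (C := ‖B x - C x‖)
    (fun s hs => (norm_expOp_apply_le hB hs.1 _).trans
      (norm_expOp_apply_le hC (sub_nonneg.2 hs.2.le) _)) t ⟨ht, le_rfl⟩
  simpa [expOp_zero, mul_comm] using this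

end BoundedGenerators

/-! ### m-dissipative graphs, Yosida approximation and generation -/

section MDissipative

variable {H : Type*} [NormedAddCommGroup H] [InnerProductSpace ℂ H]

/-- The graph `A` is that of an m-dissipative operator on a Hilbert space. -/
structure IsMDissipative (A : H → H → Prop) : Prop where
  add : ∀ {x y x' y'}, A x y → A x' y' → A (x + x') (y + y')
  smul : ∀ (c : ℂ) {x y}, A x y → A (c • x) (c • y)
  re_inner_nonpos : ∀ {x y}, A x y → RCLike.re (inner ℂ y x) ≤ 0
  eq_zero : ∀ {y}, A 0 y → y = 0
  surj : ∀ h : ℝ, 0 < h → ∀ f, ∃ x y, A x y ∧ x - (h : ℂ) • y = f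

namespace IsMDissipative

variable {A : H → H → Prop}

lemma sub (hA : IsMDissipative A) {x y x' y' : H} (h : A x y) (h' : A x' y') :
    A (x - x') (y - y') := by
  have := hA.add h (hA.smul (-1) h')
  simpa [sub_eq_add_neg] using this

/-- Pair x - hy with x: the term -h Re⟨y, x⟩ is nonnegative, and Cauchy–Schwarz does the rest. This
yields both uniqueness for the resolvent equation and contractivity of the resolvent. -/
lemma norm_le (hA : IsMDissipative A) {x y : H} (hxy : A x y) {h : ℝ} (hh : 0 < h) :
    ‖x‖ ≤ ‖x - (h : ℂ) • y‖ := by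
  have h1 : RCLike.re (inner ℂ (x - (h : ℂ) • y) x) = ‖x‖ ^ 2 - h * RCLike.re (inner ℂ y x) := by
    rw [inner_sub_left, map_sub, inner_self_eq_norm_sq, inner_smul_left]
    simp
  have h2 := re_inner_le_norm (𝕜 := ℂ) (x - (h : ℂ) • y) x
  have h3 := mul_nonneg hh.le (neg_nonneg.2 (hA.re_inner_nonpos hxy))
  by_contra! hlt
  have h4 : 0 < ‖x‖ := (norm_nonneg _).trans_lt hlt
  nlinarith

lemma exists_resolvent (hA : IsMDissipative A) : ∃ J : ℝ → H →L[ℂ] H, ∀ h, 0 < h →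
    ∀ f, A (J h f) ((h : ℂ)⁻¹ • (J h f - f)) := by
  have key : ∀ h : ℝ, 0 < h → ∃ J : H →L[ℂ] H, ∀ f, A (J f) ((h : ℂ)⁻¹ • (J f - f)) := by
    intro h hh
    have hc : (h : ℂ) ≠ 0 := by exact_mod_cast hh.ne'
    choose R Y hRY hR using hA.surj h hh
    have huniq : ∀ {x y f}, A x y → x - (h : ℂ) • y = f → R f = x := by
      intro x y f hxy hf
      have h1 := hA.norm_le (hA.sub (hRY f) hxy) hh
      have h2 : R f - x - (h : ℂ) • (Y f - y) = 0 := by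
        rw [smul_sub, sub_sub_sub_comm, hR, hf, sub_self]
      rw [h2, norm_zero] at h1
      exact sub_eq_zero.1 (norm_le_zero_iff.1 h1)
    let L : H →ₗ[ℂ] H :=
      { toFun := R
        map_add' := fun f g => huniq (hA.add (hRY f) (hRY g)) (by
          rw [smul_add, add_sub_add_comm, hR, hR])
        map_smul' := fun c f => huniq (hA.smul c (hRY f)) (by
          rw [smul_comm, RingHom.id_apply, ← smul_sub, hR]) }
    refine ⟨L.mkContinuous 1 fun f => ?_, fun f => ?_⟩
    · have := hA.norm_le (hRY f) hh
      rw [hR] at this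
      simpa [L] using this
    · have e : Y f = (h : ℂ)⁻¹ • (R f - f) := by
        rw [eq_inv_smul_iff₀ hc, eq_sub_iff_add_eq, ← eq_sub_iff_add_eq', hR]
      rw [LinearMap.mkContinuous_apply]
      change A (R f) ((h : ℂ)⁻¹ • (R f - f))
      rw [← e]
      exact hRY f
  choose! J hJ using key
  exact ⟨J, hJ⟩

/-- The resolvent `(1 - h A)⁻¹` for `h > 0`. -/
def resolvent (hA : IsMDissipative A) : ℝ → H →L[ℂ] H := Classical.choose hA.exists_resolvent

lemma resolvent_graph (hA : IsMDissipative A) {h : ℝ} (hh : 0 < h) (f : H) :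
    A (hA.resolvent h f) ((h : ℂ)⁻¹ • (hA.resolvent h f - f)) :=
  Classical.choose_spec hA.exists_resolvent h hh f

lemma resolvent_eq (hA : IsMDissipative A) {h : ℝ} (hh : 0 < h) {x y : H} (hxy : A x y) :
    hA.resolvent h (x - (h : ℂ) • y) = x := by
  have hc : (h : ℂ) ≠ 0 := by exact_mod_cast hh.ne'
  have h1 := hA.norm_le (hA.sub (hA.resolvent_graph hh (x - (h : ℂ) • y)) hxy) hh
  rw [smul_sub, smul_inv_smul₀ hc, show ∀ a b c : H, a - b - (a - (b - c) - c) = 0 by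
    intros; abel, norm_zero] at h1
  exact sub_eq_zero.1 (norm_le_zero_iff.1 h1)

lemma norm_resolvent_le (hA : IsMDissipative A) {h : ℝ} (hh : 0 < h) (f : H) :
    ‖hA.resolvent h f‖ ≤ ‖f‖ := by
  have hc : (h : ℂ) ≠ 0 := by exact_mod_cast hh.ne'
  have h1 := hA.norm_le (hA.resolvent_graph hh f) hh
  rwa [smul_inv_smul₀ hc, sub_sub_cancel] at h1

/-- The Yosida approximation `h⁻¹ ((1 - h A)⁻¹ - 1)`. -/
def yosida (hA : IsMDissipative A) (h : ℝ) : H →L[ℂ] H := (h : ℂ)⁻¹ • (hA.resolvent h - 1)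

lemma yosida_apply (hA : IsMDissipative A) (h : ℝ) (x : H) :
    hA.yosida h x = (h : ℂ)⁻¹ • (hA.resolvent h x - x) := rfl

/-- On the domain A_h x = J_h A x, so convergence of the Yosida approximations reduces to strong
convergence of J_h to the identity. -/
lemma yosida_eq (hA : IsMDissipative A) {h : ℝ} (hh : 0 < h) {x y : H} (hxy : A x y) :
    hA.yosida h x = hA.resolvent h y := by
  have hc : (h : ℂ) ≠ 0 := by exact_mod_cast hh.ne'
  have h1 := hA.resolvent_eq hh hxy
  rw [map_sub, map_smul] at h1
  rw [yosida_apply, inv_smul_eq_iff₀ hc]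
  nth_rewrite 2 [← h1]
  abel

lemma re_inner_yosida_nonpos (hA : IsMDissipative A) {h : ℝ} (hh : 0 < h) (x : H) :
    RCLike.re (inner ℂ (hA.yosida h x) x) ≤ 0 := by
  rw [yosida_apply, inner_smul_left, inner_sub_left, ← Complex.ofReal_inv, Complex.conj_ofReal]
  have h1 := re_inner_le_norm (𝕜 := ℂ) (hA.resolvent h x) x
  have h2 := mul_le_mul_of_nonneg_right (hA.norm_resolvent_le hh x) (norm_nonneg x)
  have h3 : RCLike.re (inner ℂ x x) = ‖x‖ ^ 2 := inner_self_eq_norm_sq x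
  have h4 : RCLike.re (((h⁻¹ : ℝ) : ℂ) * (inner ℂ (hA.resolvent h x) x - inner ℂ x x)) =
      h⁻¹ * (RCLike.re (inner ℂ (hA.resolvent h x) x) - RCLike.re (inner ℂ x x)) := by
    simp
  rw [h4]
  exact mul_nonpos_of_nonneg_of_nonpos (inv_nonneg.2 hh.le) (by rw [h3]; nlinarith)

lemma graph_resolvent (hA : IsMDissipative A) {h : ℝ} (hh : 0 < h) {x y : H} (hxy : A x y) :
    A (hA.resolvent h x) (hA.resolvent h y) := by
  rw [← hA.yosida_eq hh hxy]
  exact hA.resolvent_graph hh x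

/-- Resolvents preserve the graph, so J_h J_k f solves the resolvent equation of parameter k with
right-hand side J_h f, whose solution is unique. -/
lemma commute_resolvent (hA : IsMDissipative A) {h k : ℝ} (hh : 0 < h) (hk : 0 < k) :
    Commute (hA.resolvent h) (hA.resolvent k) := by
  have hc : (k : ℂ) ≠ 0 := by exact_mod_cast hk.ne'
  ext f
  have h1 := hA.resolvent_eq hk (hA.graph_resolvent hh (hA.resolvent_graph hk f))
  rw [map_smul, smul_inv_smul₀ hc, map_sub (hA.resolvent h), sub_sub_cancel] at h1
  exact h1.symm

lemma commute_yosida (hA : IsMDissipative A) {h k : ℝ} (hh : 0 < h) (hk : 0 < k) :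
    Commute (hA.yosida h) (hA.yosida k) := by
  unfold yosida
  refine Commute.smul_left (Commute.smul_right ?_ _) _
  exact ((hA.commute_resolvent hh hk).sub_left (Commute.one_left _)).sub_right
    ((Commute.one_right _))

variable [CompleteSpace H]

/-- If z = x - Ax is orthogonal to the domain, then ‖x‖² = Re⟨Ax, x⟩ ≤ 0, so x = 0;
single-valuedness then forces z = 0. -/
lemma dense_domain (hA : IsMDissipative A) : Dense {x | ∃ y, A x y} := by
  let D : Submodule ℂ H :=
    { carrier := {x | ∃ y, A x y}
      add_mem' := fun ⟨y, h⟩ ⟨y', h'⟩ => ⟨_, hA.add h h'⟩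
      zero_mem' := by
        obtain ⟨x, y, h, -⟩ := hA.surj 1 one_pos 0
        exact ⟨_, by simpa using hA.smul 0 h⟩
      smul_mem' := fun c _ ⟨y, h⟩ => ⟨_, hA.smul c h⟩ }
  change Dense (D : Set H)
  rw [Submodule.dense_iff_topologicalClosure_eq_top, Submodule.topologicalClosure_eq_top_iff,
    Submodule.eq_bot_iff]
  intro z hz
  obtain ⟨x, y, hxy, rfl⟩ := hA.surj 1 one_pos z
  have h1 : inner ℂ x (x - ((1 : ℝ) : ℂ) • y) = 0 := hz x ⟨y, hxy⟩
  have h2 := hA.re_inner_nonpos hxy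
  have h3 : RCLike.re (inner ℂ x (x - ((1 : ℝ) : ℂ) • y)) = 0 := by rw [h1]; simp
  rw [Complex.ofReal_one, one_smul, inner_sub_right, map_sub, inner_self_eq_norm_sq,
    inner_re_symm] at h3
  have h4 : x = 0 := by
    have : ‖x‖ ^ 2 ≤ 0 := by linarith
    simpa using this
  subst h4
  rw [hA.eq_zero hxy]
  simp

/-- On the domain J_h z - z = h J_h A z is of order h; density and uniform contractivity extend the
convergence to all x. -/
lemma tendsto_resolvent (hA : IsMDissipative A) (x : H) :
    Tendsto (fun h => hA.resolvent h x) (𝓝[>] 0) (𝓝 x) := by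
  rw [Metric.tendsto_nhds]
  intro ε hε
  obtain ⟨z, ⟨y, hzy⟩, hz⟩ := hA.dense_domain.exists_dist_lt x (show 0 < ε / 4 by positivity)
  have h1 : ∀ᶠ h : ℝ in 𝓝[>] 0, h * ‖y‖ < ε / 4 := by
    have : Tendsto (fun h : ℝ => h * ‖y‖) (𝓝[>] 0) (𝓝 (0 * ‖y‖)) :=
      (tendsto_nhdsWithin_of_tendsto_nhds tendsto_id).mul_const _
    rw [zero_mul] at this
    exact this.eventually_lt_const (by positivity)
  filter_upwards [h1, self_mem_nhdsWithin] with h h1 (hh : 0 < h)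
  have hc : (h : ℂ) ≠ 0 := by exact_mod_cast hh.ne'
  have h2 : ‖hA.resolvent h z - z‖ ≤ h * ‖y‖ := by
    have := hA.yosida_eq hh hzy
    rw [yosida_apply, inv_smul_eq_iff₀ hc] at this
    rw [this, norm_smul, Complex.norm_real, Real.norm_of_nonneg hh.le]
    gcongr
    exact hA.norm_resolvent_le hh y
  have h3 : ‖hA.resolvent h (x - z)‖ ≤ ‖x - z‖ := hA.norm_resolvent_le hh _
  rw [dist_eq_norm] at hz ⊢
  have h4 : hA.resolvent h x - x = hA.resolvent h (x - z) + (hA.resolvent h z - z) - (x - z) := by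
    rw [map_sub]; abel
  rw [h4]
  have := norm_sub_le (hA.resolvent h (x - z) + (hA.resolvent h z - z)) (x - z)
  have := norm_add_le (hA.resolvent h (x - z)) (hA.resolvent h z - z)
  linarith

lemma tendsto_yosida (hA : IsMDissipative A) {x y : H} (hxy : A x y) :
    Tendsto (fun h => hA.yosida h x) (𝓝[>] 0) (𝓝 y) := by
  refine (hA.tendsto_resolvent y).congr' ?_
  filter_upwards [self_mem_nhdsWithin] with h hh
  exact (hA.yosida_eq hh hxy).symm

/-- On the domain the exponentials form a Cauchy family, because they differ by at most t‖A_h z -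
A_k z‖ and the Yosida approximations converge there. Density and contractivity handle general x. -/
lemma exists_tendsto_expOp (hA : IsMDissipative A) {t : ℝ} (ht : 0 ≤ t) (x : H) :
    ∃ z, Tendsto (fun h => expOp (hA.yosida h) t x) (𝓝[>] 0) (𝓝 z) := by
  rw [← cauchy_map_iff_exists_tendsto, Metric.cauchy_iff]
  refine ⟨inferInstance, fun ε hε => ?_⟩
  obtain ⟨z, ⟨y, hzy⟩, hz⟩ := hA.dense_domain.exists_dist_lt x (show 0 < ε / 4 by positivity)
  -- Two such errors, multiplied by t, total at most ε/4; using t + 1 avoids dividing by zero at t =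
  -- 0.
  have h1 : ∀ᶠ h : ℝ in 𝓝[>] 0, dist (hA.yosida h z) y < ε / (8 * (t + 1)) :=
    (hA.tendsto_yosida hzy).eventually (Metric.ball_mem_nhds _ (by positivity))
  refine ⟨_, image_mem_map (h1.and self_mem_nhdsWithin), ?_⟩
  rintro _ ⟨h, ⟨h1, hh⟩, rfl⟩ _ ⟨k, ⟨k1, hk⟩, rfl⟩
  have hh : 0 < h := hh
  have hk : 0 < k := hk
  have e1 := norm_expOp_sub_le (hA.re_inner_yosida_nonpos hh) (hA.re_inner_yosida_nonpos hk)
    (hA.commute_yosida hh hk) ht z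
  have e2 := norm_expOp_apply_le (hA.re_inner_yosida_nonpos hh) ht (x - z)
  have e3 := norm_expOp_apply_le (hA.re_inner_yosida_nonpos hk) ht (x - z)
  have e4 : ‖hA.yosida h z - hA.yosida k z‖ < ε / (4 * (t + 1)) := by
    rw [← dist_eq_norm]
    refine (dist_triangle_right _ _ y).trans_lt ?_
    have : ε / (4 * (t + 1)) = ε / (8 * (t + 1)) + ε / (8 * (t + 1)) := by field_simp; norm_num
    rw [this]
    exact add_lt_add h1 k1
  have e5 : t * ‖hA.yosida h z - hA.yosida k z‖ ≤ ε / 4 := by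
    calc t * ‖hA.yosida h z - hA.yosida k z‖ ≤ (t + 1) * (ε / (4 * (t + 1))) := by
          gcongr; linarith
      _ = ε / 4 := by field_simp
  rw [dist_eq_norm] at hz ⊢
  have e6 : expOp (hA.yosida h) t x - expOp (hA.yosida k) t x =
      expOp (hA.yosida h) t (x - z) - expOp (hA.yosida k) t (x - z) +
        (expOp (hA.yosida h) t z - expOp (hA.yosida k) t z) := by
    rw [map_sub, map_sub]; abel
  rw [e6]
  have := norm_add_le (expOp (hA.yosida h) t (x - z) - expOp (hA.yosida k) t (x - z))
    (expOp (hA.yosida h) t z - expOp (hA.yosida k) t z)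
  have := norm_sub_le (expOp (hA.yosida h) t (x - z)) (expOp (hA.yosida k) t (x - z))
  linarith

/-- The contraction semigroup generated by an m-dissipative operator. -/
def semigroup (hA : IsMDissipative A) (t : ℝ≥0) : H →L[ℂ] H :=
  continuousLinearMapOfTendsto (l := 𝓝[>] (0 : ℝ)) (fun h => expOp (hA.yosida h) t)
    (f := fun x => Classical.choose (hA.exists_tendsto_expOp t.2 x))
    (tendsto_pi_nhds.2 fun x => Classical.choose_spec (hA.exists_tendsto_expOp t.2 x))

lemma tendsto_expOp (hA : IsMDissipative A) (t : ℝ≥0) (x : H) :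
    Tendsto (fun h => expOp (hA.yosida h) t x) (𝓝[>] 0) (𝓝 (hA.semigroup t x)) :=
  Classical.choose_spec (hA.exists_tendsto_expOp t.2 x)

lemma norm_semigroup_le (hA : IsMDissipative A) (t : ℝ≥0) (x : H) :
    ‖hA.semigroup t x‖ ≤ ‖x‖ := by
  refine le_of_tendsto (hA.tendsto_expOp t x).norm ?_
  filter_upwards [self_mem_nhdsWithin] with h hh
  exact norm_expOp_apply_le (hA.re_inner_yosida_nonpos hh) t.2 x

lemma norm_expOp_sub_semigroup_le (hA : IsMDissipative A) (t : ℝ≥0) {x y : H} (hxy : A x y)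
    {h : ℝ} (hh : 0 < h) :
    ‖expOp (hA.yosida h) t x - hA.semigroup t x‖ ≤ t * ‖hA.yosida h x - y‖ := by
  refine le_of_tendsto_of_tendsto (tendsto_const_nhds.sub (hA.tendsto_expOp t x)).norm
    ((tendsto_const_nhds.sub (hA.tendsto_yosida hxy)).norm.const_mul (t : ℝ)) ?_
  filter_upwards [self_mem_nhdsWithin] with k hk
  exact norm_expOp_sub_le (hA.re_inner_yosida_nonpos hh) (hA.re_inner_yosida_nonpos hk)
    (hA.commute_yosida hh hk) t.2 x

lemma norm_semigroup_sub_self_le (hA : IsMDissipative A) (t : ℝ≥0) {x y : H} (hxy : A x y) :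
    ‖hA.semigroup t x - x‖ ≤ t * ‖y‖ := by
  refine le_of_tendsto_of_tendsto ((hA.tendsto_expOp t x).sub tendsto_const_nhds).norm
    ((hA.tendsto_yosida hxy).norm.const_mul (t : ℝ)) ?_
  filter_upwards [self_mem_nhdsWithin] with h hh
  -- Comparison with the zero generator, whose exponential is the identity.
  have := norm_expOp_sub_le (hA.re_inner_yosida_nonpos hh) (C := 0) (by simp)
    (Commute.zero_right _) t.2 x
  simpa [expOp] using this

lemma isC0Semigroup (hA : IsMDissipative A) : IsC0Semigroup hA.semigroup where
  map_zero := by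
    ext x
    refine tendsto_nhds_unique (hA.tendsto_expOp 0 x) ?_
    simp [expOp_zero]
  map_add s t := by
    ext x
    refine tendsto_nhds_unique (hA.tendsto_expOp (s + t) x) ?_
    -- Contractivity uniform in h allows the inner vector to be replaced by its limit although the
    -- outer operator also moves.
    have h1 : Tendsto (fun h => expOp (hA.yosida h) s
        (expOp (hA.yosida h) t x - hA.semigroup t x)) (𝓝[>] 0) (𝓝 0) := by
      have h2 := (hA.tendsto_expOp t x).sub_const (hA.semigroup t x)
      rw [sub_self] at h2
      refine squeeze_zero_norm' ?_ (by simpa using h2.norm)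
      filter_upwards [self_mem_nhdsWithin] with h hh
      exact norm_expOp_apply_le (hA.re_inner_yosida_nonpos hh) s.2 _
    have h3 := h1.add (hA.tendsto_expOp s (hA.semigroup t x))
    rw [zero_add] at h3
    refine h3.congr fun h => ?_
    rw [NNReal.coe_add, expOp_add, map_sub, sub_add_cancel]
    rfl
  strong_continuity x := by
    rw [Metric.tendsto_nhds]
    intro ε hε
    obtain ⟨z, ⟨y, hzy⟩, hz⟩ := hA.dense_domain.exists_dist_lt x (show 0 < ε / 4 by positivity)
    have h1 : ∀ᶠ t : ℝ≥0 in 𝓝[>] 0, (t : ℝ) * ‖y‖ < ε / 4 := by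
      have : Tendsto (fun t : ℝ≥0 => (t : ℝ) * ‖y‖) (𝓝[>] 0) (𝓝 (((0 : ℝ≥0) : ℝ) * ‖y‖)) :=
        (tendsto_nhdsWithin_of_tendsto_nhds (NNReal.continuous_coe.tendsto 0)).mul_const _
      rw [NNReal.coe_zero, zero_mul] at this
      exact this.eventually_lt_const (by positivity)
    filter_upwards [h1] with t h1
    have h2 := hA.norm_semigroup_sub_self_le t hzy
    have h3 := hA.norm_semigroup_le t (x - z)
    rw [dist_eq_norm] at hz ⊢
    have h4 : hA.semigroup t x - x =
        hA.semigroup t (x - z) + (hA.semigroup t z - z) - (x - z) := by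
      rw [map_sub]; abel
    rw [h4]
    have := norm_sub_le (hA.semigroup t (x - z) + (hA.semigroup t z - z)) (x - z)
    have := norm_add_le (hA.semigroup t (x - z)) (hA.semigroup t z - z)
    linarith

/-- Fix one h with A_h x close to y. Replacing S(t)x by exp(tA_h)x changes the difference quotient
by at most ‖A_h x - y‖, uniformly in t, and the exponential is differentiable at 0. -/
lemma tendsto_semigroup_slope (hA : IsMDissipative A) {x y : H} (hxy : A x y) :
    Tendsto (fun t : ℝ≥0 => (((t : ℝ) : ℂ)⁻¹) • (hA.semigroup t x - x)) (𝓝[>] 0) (𝓝 y) := by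
  rw [Metric.tendsto_nhds]
  intro ε hε
  have h1 : ∀ᶠ h : ℝ in 𝓝[>] 0, dist (hA.yosida h x) y < ε / 4 :=
    (hA.tendsto_yosida hxy).eventually (Metric.ball_mem_nhds _ (by positivity))
  obtain ⟨h, h1, hh⟩ := (h1.and self_mem_nhdsWithin).exists
  have hh : 0 < h := hh
  have h2 := (hasDerivAt_expOp_apply (hA.yosida h) x 0)
  rw [hasDerivAt_iff_tendsto_slope_zero] at h2
  have h3 : Tendsto (fun t : ℝ≥0 => (t : ℝ)) (𝓝[>] 0) (𝓝[≠] 0) := by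
    refine tendsto_nhdsWithin_iff.2 ⟨tendsto_nhdsWithin_of_tendsto_nhds
      (NNReal.continuous_coe.tendsto 0), ?_⟩
    filter_upwards [self_mem_nhdsWithin] with t ht
    exact (NNReal.coe_pos.2 ht).ne'
  have h4 := h2.comp h3
  simp only [expOp_zero, Function.comp_def, zero_add, one_apply_eq_self] at h4
  have h5 := h4.eventually (Metric.ball_mem_nhds _ (show 0 < ε / 4 by positivity))
  filter_upwards [h5, self_mem_nhdsWithin] with t h5 (ht : 0 < t)
  have ht' : 0 < (t : ℝ) := ht
  have h6 := hA.norm_expOp_sub_semigroup_le t hxy hh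
  have e : (((t : ℝ) : ℂ)⁻¹) • (hA.semigroup t x - x) - y =
      (t : ℝ)⁻¹ • (expOp (hA.yosida h) t x - x) - hA.yosida h x + (hA.yosida h x - y)
        - (t : ℝ)⁻¹ • (expOp (hA.yosida h) t x - hA.semigroup t x) := by
    rw [← Complex.ofReal_inv, Complex.coe_smul, smul_sub, smul_sub, smul_sub]; abel
  have h7 : ‖(t : ℝ)⁻¹ • (expOp (hA.yosida h) t x - hA.semigroup t x)‖ ≤ ‖hA.yosida h x - y‖ := by
    rw [norm_smul, norm_inv, Real.norm_of_nonneg ht'.le, inv_mul_le_iff₀ ht']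
    exact h6
  rw [dist_eq_norm] at h1 h5 ⊢
  rw [e]
  have := norm_sub_le ((t : ℝ)⁻¹ • (expOp (hA.yosida h) t x - x) - hA.yosida h x +
    (hA.yosida h x - y)) ((t : ℝ)⁻¹ • (expOp (hA.yosida h) t x - hA.semigroup t x))
  have := norm_add_le ((t : ℝ)⁻¹ • (expOp (hA.yosida h) t x - x) - hA.yosida h x)
    (hA.yosida h x - y)
  linarith

/-- The generation theorem for m-dissipative operators on a Hilbert space. -/
theorem generates (hA : IsMDissipative A) : Generates A hA.semigroup := by
  refine ⟨hA.isC0Semigroup, fun x y => ⟨hA.tendsto_semigroup_slope, fun hxy => ?_⟩⟩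
  -- The generator of a contraction semigroup is dissipative, so 1 minus the generator is injective.
  -- As 1 - A is already onto, the generator cannot be a proper extension of A.
  obtain ⟨z, w, hzw, hz⟩ := hA.surj 1 one_pos (x - y)
  have h1 := hxy.sub (hA.tendsto_semigroup_slope hzw)
  have h2 : y - w = x - z := by
    rw [Complex.ofReal_one, one_smul] at hz
    rw [sub_eq_sub_iff_add_eq_add] at hz ⊢
    rw [add_comm, ← hz, add_comm]
  have h3 : Tendsto (fun t : ℝ≥0 => RCLike.re (inner ℂ
      ((((t : ℝ) : ℂ)⁻¹) • (hA.semigroup t (x - z) - (x - z))) (x - z)))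
      (𝓝[>] 0) (𝓝 (RCLike.re (inner ℂ (y - w) (x - z)))) := by
    refine ((RCLike.continuous_re.tendsto _).comp (h1.inner tendsto_const_nhds)).congr fun t => ?_
    simp only [Function.comp_def, ← smul_sub, map_sub]
    rw [sub_sub_sub_comm]
  have h4 : RCLike.re (inner ℂ (y - w) (x - z)) ≤ 0 := by
    refine le_of_tendsto h3 (Eventually.of_forall fun t => ?_)
    have e1 := re_inner_le_norm (𝕜 := ℂ) (hA.semigroup t (x - z)) (x - z)
    have e2 := mul_le_mul_of_nonneg_right (hA.norm_semigroup_le t (x - z)) (norm_nonneg (x - z))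
    have e3 : RCLike.re (inner ℂ (x - z) (x - z)) = ‖x - z‖ ^ 2 := inner_self_eq_norm_sq (x - z)
    rw [inner_smul_left, inner_sub_left, ← Complex.ofReal_inv, Complex.conj_ofReal]
    have e4 : RCLike.re ((((t : ℝ)⁻¹ : ℝ) : ℂ) *
        (inner ℂ (hA.semigroup t (x - z)) (x - z) - inner ℂ (x - z) (x - z))) =
        (t : ℝ)⁻¹ * (RCLike.re (inner ℂ (hA.semigroup t (x - z)) (x - z)) -
          RCLike.re (inner ℂ (x - z) (x - z))) := by
      simp
    rw [e4]
    exact mul_nonpos_of_nonneg_of_nonpos (inv_nonneg.2 t.2) (by rw [e3]; nlinarith)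
  rw [h2, inner_self_eq_norm_sq] at h4
  have h5 : x - z = 0 := by simpa using h4
  rw [h5] at h2
  rw [sub_eq_zero.1 h5, sub_eq_zero.1 h2]
  exact hzw

end IsMDissipative

end MDissipative

/-! ### Orbits of an arbitrary C₀-semigroup -/

section Orbits

variable {H : Type*} [NormedAddCommGroup H] [NormedSpace ℂ H] {S : ℝ≥0 → H →L[ℂ] H}

namespace IsC0Semigroup

lemma tendsto_nhds_zero (hS : IsC0Semigroup S) (x : H) :
    Tendsto (fun t => S t x) (𝓝 0) (𝓝 x) := by
  have h : (𝓝 (0 : ℝ≥0)) = pure 0 ⊔ 𝓝[>] 0 := by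
    have h1 : insert (0 : ℝ≥0) (Set.Ioi 0) = Set.univ := by
      ext t; simp
    rw [← nhdsWithin_insert, h1, nhdsWithin_univ]
  rw [h]
  refine Tendsto.sup ?_ (hS.strong_continuity x)
  rw [tendsto_pure_left]
  intro s hs
  rw [hS.map_zero]
  exact mem_of_mem_nhds hs

/-- Otherwise there are t_n → 0 with ‖S(t_n)‖ > n, although every orbit t ↦ S(t)x converges at 0;
this contradicts Banach–Steinhaus. -/
lemma exists_bound_near_zero [CompleteSpace H] (hS : IsC0Semigroup S) :
    ∃ δ : ℝ≥0, 0 < δ ∧ ∃ M : ℝ, ∀ t ≤ δ, ‖S t‖ ≤ M := by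
  by_contra! hcon
  have h1 : ∀ n : ℕ, ∃ t : ℝ≥0, t ≤ 1 / ((n : ℝ≥0) + 1) ∧ (n : ℝ) < ‖S t‖ := fun n =>
    hcon _ (by positivity) n
  choose t ht hn using h1
  have ht0 : Tendsto t atTop (𝓝 0) :=
    tendsto_of_tendsto_of_tendsto_of_le_of_le tendsto_const_nhds
      tendsto_one_div_add_atTop_nhds_zero_nat (fun _ => zero_le) ht
  obtain ⟨C, hC⟩ := banach_steinhaus (g := fun n => S (t n)) fun x => by
    have := ((hS.tendsto_nhds_zero x).comp ht0).norm.bddAbove_range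
    obtain ⟨C, hC⟩ := this
    exact ⟨C, fun n => hC ⟨n, rfl⟩⟩
  obtain ⟨n, hn'⟩ := exists_nat_gt C
  linarith [hC n, hn n]

lemma exists_bound [CompleteSpace H] (hS : IsC0Semigroup S) (T : ℝ≥0) :
    ∃ M : ℝ, ∀ t ≤ T, ‖S t‖ ≤ M := by
  obtain ⟨δ, hδ, M, hM⟩ := hS.exists_bound_near_zero
  have hM0 : 0 ≤ M := (norm_nonneg _).trans (hM 0 zero_le)
  have key : ∀ n : ℕ, ∃ C : ℝ, ∀ t ≤ n * δ, ‖S t‖ ≤ C := by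
    intro n
    induction n with
    | zero => exact ⟨M, fun t ht => hM t (ht.trans (by simp))⟩
    | succ n ih =>
      obtain ⟨C, hC⟩ := ih
      have hC0 : 0 ≤ C := (norm_nonneg _).trans (hC 0 zero_le)
      refine ⟨max M (M * C), fun t ht => ?_⟩
      rcases le_total t δ with h | h
      · exact (hM t h).trans (le_max_left _ _)
      · refine le_trans ?_ (le_max_right _ _)
        have h1 : t = δ + (t - δ) := (add_tsub_cancel_of_le h).symm
        rw [h1, hS.map_add]
        refine (ContinuousLinearMap.opNorm_comp_le _ _).trans ?_
        gcongr
        · exact hM δ le_rfl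
        · refine hC _ (tsub_le_iff_right.2 (ht.trans ?_))
          push_cast
          rw [add_mul, one_mul]
  obtain ⟨n, hn⟩ := exists_nat_gt (T / δ)
  obtain ⟨C, hC⟩ := key n
  exact ⟨C, fun t ht => hC t (ht.trans ((div_le_iff₀ hδ).1 hn.le))⟩

/-- For s ≤ t one has S(t)x - S(s)x = S(s)(S(t - s)x - x). The local bound on ‖S(s)‖ is what gives
continuity from the left, where s varies. -/
lemma continuous_orbit [CompleteSpace H] (hS : IsC0Semigroup S) (x : H) :
    Continuous fun t => S t x := by
  rw [continuous_iff_continuousAt]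
  intro t₀
  obtain ⟨M, hM⟩ := hS.exists_bound (t₀ + 1)
  have h1 : Tendsto (fun t => S (nndist t t₀) x) (𝓝 t₀) (𝓝 x) := by
    refine (hS.tendsto_nhds_zero x).comp ?_
    have : Continuous fun t : ℝ≥0 => nndist t t₀ := by fun_prop
    simpa using this.tendsto t₀
  have h2 : Tendsto (fun t => M * ‖S (nndist t t₀) x - x‖) (𝓝 t₀) (𝓝 0) := by
    simpa using (h1.sub_const x).norm.const_mul M
  rw [ContinuousAt, tendsto_iff_norm_sub_tendsto_zero]
  refine squeeze_zero' (Eventually.of_forall fun _ => norm_nonneg _) ?_ h2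
  have hlt : ∀ᶠ t : ℝ≥0 in 𝓝 t₀, t < t₀ + 1 := eventually_lt_nhds (by simp)
  have key : ∀ s t : ℝ≥0, s ≤ t → s ≤ t₀ + 1 →
      ‖S t x - S s x‖ ≤ M * ‖S (nndist t s) x - x‖ := by
    intro s t hst hs
    have e : t = s + nndist t s := by
      rw [← NNReal.coe_inj]
      push_cast
      rw [NNReal.dist_eq, abs_of_nonneg (sub_nonneg.2 (NNReal.coe_le_coe.2 hst))]
      ring
    have e2 : S t x - S s x = S s (S (nndist t s) x - x) := by
      conv_lhs => rw [e, hS.map_add]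
      simp
    rw [e2]
    exact (S s).le_of_opNorm_le (hM s hs) _
  filter_upwards [hlt] with t ht
  rcases le_total t₀ t with h | h
  · exact key _ _ h (by simp)
  · rw [norm_sub_rev, nndist_comm]
    exact key _ _ h ht.le

end IsC0Semigroup

/-- S(t) commutes with S(s), hence with the difference quotients defining the generator. -/
lemma Generates.graph_orbit {A : H → H → Prop} (hS : Generates A S) {x y : H} (hxy : A x y)
    (t : ℝ≥0) : A (S t x) (S t y) := by
  rw [hS.2] at hxy ⊢
  refine (((S t).continuous.tendsto y).comp hxy).congr fun s => ?_
  have : S s (S t x) = S t (S s x) := by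
    rw [← ContinuousLinearMap.comp_apply, ← ContinuousLinearMap.comp_apply, ← hS.1.map_add,
      ← hS.1.map_add, add_comm]
  simp [this]

end Orbits

/-! ### Invariant sets: from resolvents to semigroups -/

section Invariance

variable {H : Type*} [NormedAddCommGroup H] [InnerProductSpace ℂ H] [CompleteSpace H]
  {A : H → H → Prop} {S : ℝ≥0 → H →L[ℂ] H} {C : Set H}

/-- Along an orbit in the domain the distance to a set that is invariant under the resolvents
does not increase. -/
lemma IsMDissipative.infDist_orbit_le (hA : IsMDissipative A) (hS : Generates A S)
    (hne : C.Nonempty) (hJ : ∀ h, 0 < h → ∀ x ∈ C, hA.resolvent h x ∈ C) {x y : H}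
    (hxy : A x y) (T : ℝ≥0) : Metric.infDist (S T x) C ≤ Metric.infDist x C := by
  -- The resolvent is 1-Lipschitz and maps C into itself, so it cannot increase the distance to C.
  have hJd : ∀ h, 0 < h → ∀ u, Metric.infDist (hA.resolvent h u) C ≤ Metric.infDist u C := by
    intro h hh u
    refine (Metric.le_infDist hne).2 fun c hc => ?_
    refine (Metric.infDist_le_dist_of_mem (hJ h hh c hc)).trans ?_
    rw [dist_eq_norm, dist_eq_norm, ← map_sub]
    exact hA.norm_resolvent_le hh _
  have hcont : Continuous fun s : ℝ => Metric.infDist (S s.toNNReal x) C :=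
    (Metric.continuous_infDist_pt C).comp
      ((hS.1.continuous_orbit x).comp continuous_real_toNNReal)
  have := image_le_of_liminf_slope_right_le_deriv_boundary (a := 0) (b := T)
    hcont.continuousOn (B := fun _ => Metric.infDist x C) (B' := fun _ => 0) ?_
    continuousOn_const (fun _ _ => hasDerivWithinAt_const _ _ _) ?_
    (show (T : ℝ) ∈ Set.Icc 0 (T : ℝ) from ⟨T.2, le_rfl⟩)
  · simpa using this
  · simp [hS.1.map_zero]
  intro t ht r hr
  apply Eventually.frequently
  set τ : ℝ≥0 := t.toNNReal with hτ
  have hτt : (τ : ℝ) = t := Real.coe_toNNReal t ht.1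
  have hu := hS.graph_orbit hxy τ
  have h1 := (hS.2 _ _).1 hu
  -- S(s)u and J_s u agree to first order as s → 0, since both difference quotients tend to Au.
  -- Hence the distance to C grows by at most o(s), and a vanishing upper right slope bound makes it
  -- nonincreasing.
  have h2 := hA.tendsto_yosida hu
  have h2' : Tendsto (fun s : ℝ≥0 => hA.yosida (s : ℝ) (S τ x)) (𝓝[>] 0) (𝓝 (S τ y)) := by
    refine h2.comp (tendsto_nhdsWithin_iff.2 ⟨tendsto_nhdsWithin_of_tendsto_nhds
      (NNReal.continuous_coe.tendsto 0), ?_⟩)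
    filter_upwards [self_mem_nhdsWithin] with s hs
    exact NNReal.coe_pos.2 hs
  have h3 := (h1.sub h2').norm
  rw [sub_self, norm_zero] at h3
  have h4 : Tendsto (fun z : ℝ => (z - t).toNNReal) (𝓝[>] t) (𝓝[>] 0) := by
    refine tendsto_nhdsWithin_iff.2 ⟨?_, ?_⟩
    · have : Continuous fun z : ℝ => (z - t).toNNReal := by fun_prop
      simpa using tendsto_nhdsWithin_of_tendsto_nhds (s := Set.Ioi t) (this.tendsto t)
    · filter_upwards [self_mem_nhdsWithin] with z hz
      exact Real.toNNReal_pos.2 (sub_pos.2 hz)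
  filter_upwards [(h3.comp h4).eventually_lt_const hr, self_mem_nhdsWithin] with z hz (htz : t < z)
  have hs : 0 < z - t := sub_pos.2 htz
  have hc : ((z - t : ℝ) : ℂ) ≠ 0 := by exact_mod_cast hs.ne'
  have hz1 : z.toNNReal = (z - t).toNNReal + τ := by
    rw [hτ, ← Real.toNNReal_add hs.le ht.1, sub_add_cancel]
  simp only [Function.comp_def, Real.coe_toNNReal _ hs.le, hA.yosida_apply, ← smul_sub] at hz
  rw [sub_sub_sub_cancel_right, norm_smul, norm_inv, Complex.norm_real,
    Real.norm_of_nonneg hs.le, inv_mul_lt_iff₀ hs] at hz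
  rw [slope_def_field, div_lt_iff₀ hs, ← hτ, hz1, hS.1.map_add, ContinuousLinearMap.comp_apply]
  have h5 := Metric.infDist_le_infDist_add_dist (s := C) (x := S (z - t).toNNReal (S τ x))
    (y := hA.resolvent (z - t) (S τ x))
  rw [dist_eq_norm] at h5
  have h6 := hJd _ hs (S τ x)
  linarith

/-- A closed set that is invariant under the resolvents of an m-dissipative operator is invariant
under the semigroup that it generates. -/
theorem IsMDissipative.mapsTo_of_resolvent (hA : IsMDissipative A) (hS : Generates A S)
    (hC : IsClosed C) (hJ : ∀ h, 0 < h → ∀ x ∈ C, hA.resolvent h x ∈ C)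
    (t : ℝ≥0) {x : H} (hx : x ∈ C) : S t x ∈ C := by
  have hne : C.Nonempty := ⟨x, hx⟩
  have h1 : ∀ x : H, Metric.infDist (S t x) C ≤ Metric.infDist x C := by
    have hcl : IsClosed {x : H | Metric.infDist (S t x) C ≤ Metric.infDist x C} :=
      isClosed_le ((Metric.continuous_infDist_pt C).comp (S t).continuous)
        (Metric.continuous_infDist_pt C)
    intro x
    refine hcl.closure_subset_iff.2 ?_ (hA.dense_domain x)
    rintro z ⟨y, hzy⟩
    exact hA.infDist_orbit_le hS hne hJ hzy t
  rw [hC.mem_iff_infDist_zero hne]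
  refine le_antisymm ((h1 x).trans ?_) Metric.infDist_nonneg
  rw [Metric.infDist_zero_of_mem hx]

end Invariance

/-! ### Operators associated with closed accretive forms -/

section Form

/-- The Lax–Milgram theorem for complex Hilbert spaces. -/
lemma surjective_of_coercive {V : Type*} [NormedAddCommGroup V] [InnerProductSpace ℂ V]
    [CompleteSpace V] (T : V →L[ℂ] V) {c : ℝ} (hc : 0 < c)
    (hT : ∀ x, c * ‖x‖ ^ 2 ≤ RCLike.re (inner ℂ x (T x))) : Function.Surjective T := by
  have hb : ∀ x, ‖x‖ ≤ c⁻¹ * ‖T x‖ := by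
    intro x
    have h1 := (hT x).trans (re_inner_le_norm x (T x))
    rw [le_inv_mul_iff₀ hc]
    rcases (norm_nonneg x).eq_or_lt with h | h
    · rw [← h]; simp
    · exact le_of_mul_le_mul_left (by nlinarith) h
  have hanti : AntilipschitzWith (Real.toNNReal c⁻¹) T := by
    refine AddMonoidHomClass.antilipschitz_of_bound T fun x => ?_
    rw [Real.coe_toNNReal _ (inv_nonneg.2 hc.le)]
    exact hb x
  have hcl : IsClosed (T.range : Set V) := hanti.isClosed_range T.uniformContinuous
  have := hcl.completeSpace_coe
  have htop : T.range = ⊤ := by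
    rw [← T.range.orthogonal_orthogonal, Submodule.eq_top_iff']
    intro v w hw
    have h0 : w = 0 := by
      have h1 : inner ℂ (T w) w = 0 := hw _ ⟨w, rfl⟩
      have h2 := hT w
      rw [← inner_conj_symm, h1, map_zero, map_zero] at h2
      have h3 : ‖w‖ ^ 2 ≤ 0 := by
        by_contra! h
        nlinarith [mul_pos hc h]
      simpa using h3
    rw [h0, inner_zero_left]
  exact LinearMap.range_eq_top.1 htop

variable {H G : Type*} [NormedAddCommGroup H] [InnerProductSpace ℂ H]
  [NormedAddCommGroup G] [InnerProductSpace ℂ G]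

/-- The graph of the operator associated with the form `(x, x') ↦ ⟨g, g'⟩ + ⟨D x, x'⟩` where `g`,
the gradient, is encoded by `(x, g) ∈ V`. -/
def formRel (V : Submodule ℂ (WithLp 2 (H × G))) (D : H →L[ℂ] H) (x y : H) : Prop :=
  ∃ k ∈ V, k.fst = x ∧ ∀ k' ∈ V, inner ℂ k'.fst (y + D x) + inner ℂ k'.snd k.snd = 0

variable [CompleteSpace H] [CompleteSpace G]

/-- Testing with k' = k gives dissipativity. The equation x - hy = f is the variational problem on V
for the form with h⁻¹ added, coercive in the norm of V. Closedness of V provides completeness for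
Lax–Milgram. -/
theorem formRel_isMDissipative {V : Submodule ℂ (WithLp 2 (H × G))}
    (hV : IsClosed (V : Set (WithLp 2 (H × G)))) {D : H →L[ℂ] H}
    (hD : ∀ x, 0 ≤ RCLike.re (inner ℂ x (D x)))
    (h0 : ∀ y, formRel V D 0 y → y = 0) : IsMDissipative (formRel V D) where
  add := by
    rintro _ y _ y' ⟨k, hk, rfl, h⟩ ⟨l, hl, rfl, h'⟩
    refine ⟨k + l, V.add_mem hk hl, rfl, fun k' hk' => ?_⟩
    have e : y + y' + D (k.fst + l.fst) = (y + D k.fst) + (y' + D l.fst) := by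
      rw [map_add]; abel
    rw [e, inner_add_right k'.fst (y + D k.fst), WithLp.add_snd, inner_add_right k'.snd,
      add_add_add_comm, h k' hk', h' k' hk',
      add_zero]
  smul := by
    rintro c _ y ⟨k, hk, rfl, h⟩
    refine ⟨c • k, V.smul_mem c hk, rfl, fun k' hk' => ?_⟩
    rw [map_smul, ← smul_add, inner_smul_right, WithLp.smul_snd, inner_smul_right, ← mul_add,
      h k' hk', mul_zero]
  re_inner_nonpos := by
    rintro _ y ⟨k, hk, rfl, h⟩
    have h1 := congrArg RCLike.re (h k hk)
    rw [inner_add_right, map_add, map_add, inner_self_eq_norm_sq, map_zero, inner_re_symm] at h1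
    have := hD k.fst
    have := sq_nonneg ‖k.snd‖
    linarith
  eq_zero := h0 _
  surj := by
    intro h hh f
    have hcV : CompleteSpace V := hV.completeSpace_coe
    have hc : (h : ℂ) ≠ 0 := by exact_mod_cast hh.ne'
    let e := WithLp.prodContinuousLinearEquiv 2 ℂ H G
    let L : WithLp 2 (H × G) →L[ℂ] WithLp 2 (H × G) :=
      (e.symm : (H × G) →L[ℂ] WithLp 2 (H × G)).comp
        ((((h : ℂ)⁻¹ • ContinuousLinearMap.id ℂ H + D).prodMap (ContinuousLinearMap.id ℂ G)).comp
          (e : WithLp 2 (H × G) →L[ℂ] (H × G)))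
    have hL1 : ∀ k, (L k).fst = (h : ℂ)⁻¹ • k.fst + D k.fst := fun k => rfl
    have hL2 : ∀ k, (L k).snd = k.snd := fun k => rfl
    -- T represents on V the sesquilinear form ⟨k', L k⟩; composing with the orthogonal projection
    -- turns testing against V into an equation in V.
    let T : V →L[ℂ] V := V.orthogonalProjectionOnto.comp (L.comp V.subtypeL)
    have hT : ∀ k k' : V, inner ℂ k' (T k) = inner ℂ (k' : WithLp 2 (H × G)) (L k) := fun k k' => by
      change inner ℂ k' (V.orthogonalProjectionOnto (L k)) = _
      rw [Submodule.inner_orthogonalProjectionOnto_eq_of_mem_left]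
    have hsurj : Function.Surjective T := by
      -- The form dominates h⁻¹‖x‖² + ‖g‖², since D only adds a nonnegative real part, and the
      -- squared norm on V is ‖x‖² + ‖g‖².
      refine surjective_of_coercive T (c := min h⁻¹ 1) (by positivity) fun k => ?_
      rw [hT, WithLp.prod_inner_apply, map_add]
      change _ ≤ RCLike.re (inner ℂ (k : WithLp 2 (H × G)).fst (L k).fst) +
        RCLike.re (inner ℂ (k : WithLp 2 (H × G)).snd (L k).snd)
      rw [hL1, hL2, inner_add_right, inner_smul_right, inner_self_eq_norm_sq, map_add,
        ← Complex.ofReal_inv]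
      have e1 : RCLike.re (((h⁻¹ : ℝ) : ℂ) * inner ℂ (k : WithLp 2 (H × G)).fst
          (k : WithLp 2 (H × G)).fst) = h⁻¹ * ‖(k : WithLp 2 (H × G)).fst‖ ^ 2 := by
        rw [← inner_self_eq_norm_sq (𝕜 := ℂ)]
        simp
      have e2 : ‖k‖ ^ 2 = ‖(k : WithLp 2 (H × G)).fst‖ ^ 2 + ‖(k : WithLp 2 (H × G)).snd‖ ^ 2 :=
        WithLp.prod_norm_sq_eq_of_L2 _
      rw [e1, e2, mul_add]
      have := hD (k : WithLp 2 (H × G)).fst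
      have := mul_le_mul_of_nonneg_right (min_le_left h⁻¹ 1)
        (sq_nonneg ‖(k : WithLp 2 (H × G)).fst‖)
      have := mul_le_mul_of_nonneg_right (min_le_right h⁻¹ 1)
        (sq_nonneg ‖(k : WithLp 2 (H × G)).snd‖)
      linarith
    obtain ⟨k, hk⟩ := hsurj (V.orthogonalProjectionOnto (WithLp.toLp 2 ((h : ℂ)⁻¹ • f, (0 : G))))
    refine ⟨(k : WithLp 2 (H × G)).fst, (h : ℂ)⁻¹ • ((k : WithLp 2 (H × G)).fst - f),
      ⟨k, k.2, rfl, fun k' hk' => ?_⟩, ?_⟩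
    · have h1 := hT k ⟨k', hk'⟩
      rw [hk, Submodule.inner_orthogonalProjectionOnto_eq_of_mem_left, WithLp.prod_inner_apply,
        WithLp.prod_inner_apply] at h1
      change inner ℂ k'.fst ((h : ℂ)⁻¹ • f) + inner ℂ k'.snd (0 : G) =
        inner ℂ k'.fst (L k).fst + inner ℂ k'.snd (L k).snd at h1
      rw [hL1, hL2, inner_zero_right, add_zero] at h1
      rw [smul_sub, sub_add_eq_add_sub, inner_sub_right, h1]
      ring
    · rw [smul_inv_smul₀ hc, sub_sub_cancel]

end Form

/-! ### Mollification in L¹ -/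

section Mollifier

open scoped Convolution

open ContinuousLinearMap in
/-- Mollification contracts the `L¹`-norm. -/
lemma integral_norm_normed_convolution_le {d : ℕ} (φ : ContDiffBump (0 : EuclideanSpace ℝ (Fin d)))
    {f : EuclideanSpace ℝ (Fin d) → ℂ} (hf : Integrable f) :
    ∫ x, ‖(φ.normed volume ⋆[lsmul ℝ ℝ, volume] f) x‖ ≤ ∫ x, ‖f x‖ := by
  have h1 : Integrable (φ.normed volume : EuclideanSpace ℝ (Fin d) → ℝ) := φ.integrable_normed
  have h2 := integral_convolution (μ := volume) (ν := volume) (lsmul ℝ ℝ) h1 hf.norm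
  rw [φ.integral_normed] at h2
  simp only [lsmul_apply, one_smul] at h2
  rw [← h2]
  refine integral_mono_of_nonneg (Eventually.of_forall fun _ => norm_nonneg _)
    (h1.integrable_convolution _ hf.norm) (Eventually.of_forall fun x => ?_)
  refine (norm_integral_le_integral_norm _).trans (le_of_eq ?_)
  refine integral_congr_ae (Eventually.of_forall fun t => ?_)
  simp [abs_of_nonneg (φ.nonneg_normed (μ := volume) t)]

open ContinuousLinearMap in
/-- Mollifications of an integrable function converge in `L¹`. -/
lemma tendsto_integral_norm_convolution_sub {d : ℕ}
    {φ : ℕ → ContDiffBump (0 : EuclideanSpace ℝ (Fin d))}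
    (hφ : Tendsto (fun n => (φ n).rOut) atTop (𝓝 0))
    {f : EuclideanSpace ℝ (Fin d) → ℂ} (hf : Integrable f) :
    Tendsto (fun n => ∫ x, ‖((φ n).normed volume ⋆[lsmul ℝ ℝ, volume] f) x - f x‖)
      atTop (𝓝 0) := by
  rw [Metric.tendsto_nhds]
  intro ε hε
  obtain ⟨k, hks, hk, hkc, hki⟩ := hf.exists_hasCompactSupport_integral_sub_le
    (show 0 < ε / 4 by positivity)
  set K := Metric.cthickening 1 (tsupport k) with hK
  have hKc : IsCompact K := hks.isCompact.cthickening
  set m : ℝ := volume.real K with hm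
  have hm0 : 0 ≤ m := measureReal_nonneg
  have huc := hks.uniformContinuous_of_continuous hkc
  rw [Metric.uniformContinuous_iff] at huc
  -- Once the mollifier radius is below 1 the error for k is supported in K, so a uniform error
  -- ε/(4(m + 1)) integrates to at most ε/4; m + 1 guards against m = 0.
  obtain ⟨δ, hδ, hδk⟩ := huc (ε / (4 * (m + 1))) (by positivity)
  filter_upwards [hφ.eventually_lt_const hδ, hφ.eventually_lt_const one_pos] with n hn hn1
  have hρ : Integrable ((φ n).normed volume : EuclideanSpace ℝ (Fin d) → ℝ) :=
    (φ n).integrable_normed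
  have hfk : Integrable (fun x => f x - k x) := hf.sub hki
  have hck : ∀ g : EuclideanSpace ℝ (Fin d) → ℂ, Integrable g →
      Integrable ((φ n).normed volume ⋆[lsmul ℝ ℝ, volume] g) := fun g hg =>
    hρ.integrable_convolution _ hg
  have hpt : ∀ x, ‖((φ n).normed volume ⋆[lsmul ℝ ℝ, volume] k) x - k x‖ ≤
      K.indicator (fun _ => ε / (4 * (m + 1))) x := by
    intro x
    by_cases hx : x ∈ K
    · rw [Set.indicator_of_mem hx, ← dist_eq_norm]
      refine ContDiffBump.dist_normed_convolution_le hkc.aestronglyMeasurable fun y hy => ?_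
      exact (hδk (lt_trans hy hn)).le
    · rw [Set.indicator_of_notMem hx]
      have hz : ∀ y ∈ Metric.ball x (φ n).rOut, k y = 0 := by
        intro y hy
        by_contra hne
        refine hx (Metric.mem_cthickening_of_dist_le x y 1 _ (subset_tsupport k hne) ?_)
        rw [dist_comm]
        exact (lt_trans hy hn1).le
      rw [ContDiffBump.normed_convolution_eq_right, sub_self, norm_zero]
      intro y hy
      rw [hz y hy, hz x (Metric.mem_ball_self (φ n).rOut_pos)]
  have hint : Integrable (K.indicator (fun _ => ε / (4 * (m + 1)))) (volume : Measure
      (EuclideanSpace ℝ (Fin d))) :=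
    (integrable_indicator_iff hKc.measurableSet).2
      (integrableOn_const hKc.measure_lt_top.ne)
  have h1 : ∫ x, ‖((φ n).normed volume ⋆[lsmul ℝ ℝ, volume] k) x - k x‖ ≤ ε / 4 := by
    calc _ ≤ ∫ x, K.indicator (fun _ => ε / (4 * (m + 1))) x :=
          integral_mono ((hck k hki).sub hki).norm hint hpt
      _ = m * (ε / (4 * (m + 1))) := by
          rw [integral_indicator hKc.measurableSet, setIntegral_const, smul_eq_mul]
      _ ≤ (m + 1) * (ε / (4 * (m + 1))) := by gcongr; linarith
      _ = ε / 4 := by field_simp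
  have h2 := (integral_norm_normed_convolution_le (φ n) hfk).trans hk
  have hce : ∀ g : EuclideanSpace ℝ (Fin d) → ℂ, Integrable g →
      ConvolutionExists ((φ n).normed volume) g (lsmul ℝ ℝ) volume := fun g hg =>
    (φ n).hasCompactSupport_normed.convolutionExists_left _ (φ n).continuous_normed
      hg.locallyIntegrable
  have h3 : ((φ n).normed volume ⋆[lsmul ℝ ℝ, volume] f) =
      ((φ n).normed volume ⋆[lsmul ℝ ℝ, volume] fun x => f x - k x) +
        ((φ n).normed volume ⋆[lsmul ℝ ℝ, volume] k) := by
    rw [← (hce _ hfk).distrib_add (hce k hki)]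
    congr 1
    ext x
    simp
  have h4 : ∫ x, ‖((φ n).normed volume ⋆[lsmul ℝ ℝ, volume] f) x - f x‖ ≤
      ∫ x, (‖((φ n).normed volume ⋆[lsmul ℝ ℝ, volume] fun x => f x - k x) x‖ +
        ‖((φ n).normed volume ⋆[lsmul ℝ ℝ, volume] k) x - k x‖ + ‖f x - k x‖) := by
    refine integral_mono ((hck f hf).sub hf).norm
      (((hck _ hfk).norm.add ((hck k hki).sub hki).norm).add hfk.norm) fun x => ?_
    rw [h3, Pi.add_apply]
    set a := ((φ n).normed volume ⋆[lsmul ℝ ℝ, volume] fun x => f x - k x) x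
    set b := ((φ n).normed volume ⋆[lsmul ℝ ℝ, volume] k) x
    have e : a + b - f x = a + (b - k x) - (f x - k x) := by ring
    rw [e]
    exact (norm_sub_le _ _).trans (add_le_add_left (norm_add_le _ _) _)
  have i1 : Integrable fun x => ‖((φ n).normed volume ⋆[lsmul ℝ ℝ, volume] k) x - k x‖ :=
    ((hck k hki).sub hki).norm
  have i2 : Integrable fun x => ‖((φ n).normed volume ⋆[lsmul ℝ ℝ, volume] fun x => f x - k x) x‖ +
      ‖((φ n).normed volume ⋆[lsmul ℝ ℝ, volume] k) x - k x‖ := (hck _ hfk).norm.add i1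
  rw [integral_add i2 hfk.norm, integral_add (hck _ hfk).norm i1] at h4
  rw [dist_zero_right, Real.norm_of_nonneg (integral_nonneg fun _ => norm_nonneg _)]
  linarith

end Mollifier

/-! ### The weak chain rule by mollification -/

section ChainRule

open scoped Convolution

variable {d : ℕ} {Ω : Set (EuclideanSpace ℝ (Fin d))}

open ContinuousLinearMap in
/-- Where the mollifier sees only `Ω`, differentiating a mollified `H¹`-function amounts to
mollifying its weak gradient. -/
lemma HasH1Gradient.fderiv_normed_convolution (hΩ : MeasurableSet Ω)
    {u : EuclideanSpace ℝ (Fin d) → ℂ}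
    {g : EuclideanSpace ℝ (Fin d) → EuclideanSpace ℂ (Fin d)} (h : HasH1Gradient Ω u g)
    (hu : LocallyIntegrable (Ω.indicator u)) (φ : ContDiffBump (0 : EuclideanSpace ℝ (Fin d)))
    {x : EuclideanSpace ℝ (Fin d)} (hx : Metric.closedBall x φ.rOut ⊆ Ω) (i : Fin d) :
    fderiv ℝ (φ.normed volume ⋆[lsmul ℝ ℝ, volume] Ω.indicator u) x (EuclideanSpace.single i 1) =
      (φ.normed volume ⋆[lsmul ℝ ℝ, volume] Ω.indicator fun y => g y i) x := by
  set e : EuclideanSpace ℝ (Fin d) := EuclideanSpace.single i 1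
  set ρ : EuclideanSpace ℝ (Fin d) → ℝ := φ.normed volume with hρ
  have hρs : HasCompactSupport ρ := φ.hasCompactSupport_normed
  have hρd : ContDiff ℝ ((⊤ : ℕ∞) : WithTop ℕ∞) ρ := φ.contDiff_normed
  have hρd1 : ContDiff ℝ 1 ρ := φ.contDiff_normed
  have h1 := hρs.hasFDerivAt_convolution_right (lsmul ℝ ℝ : ℝ →L[ℝ] ℂ →L[ℝ] ℂ).flip
    (μ := volume) hu hρd1 x
  rw [convolution_flip] at h1
  rw [h1.fderiv, convolution_precompR_apply _ hu (hρs.fderiv ℝ)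
    (hρd1.continuous_fderiv one_ne_zero)]
  -- The reflected and translated mollifier is supported in the ball around x, hence is an
  -- admissible test function for the weak gradient.
  let ψ : EuclideanSpace ℝ (Fin d) → ℂ := fun y => (ρ (x - y) : ℂ)
  have hψd : ∀ y, fderiv ℝ ψ y e = -(fderiv ℝ ρ (x - y) e : ℂ) := by
    intro y
    have h2 : HasFDerivAt (fun y => ρ (x - y))
        ((fderiv ℝ ρ (x - y)).comp (-ContinuousLinearMap.id ℝ _)) y :=
      ((hρd1.differentiable one_ne_zero) (x - y)).hasFDerivAt.comp y
        ((hasFDerivAt_id y).const_sub x)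
    have h3 := Complex.ofRealCLM.hasFDerivAt.comp y h2
    have h4 : fderiv ℝ ψ y = _ := h3.fderiv
    rw [h4]
    simp
  have hψ : IsTestFunction Ω ψ := by
    have hsub : Function.support ψ ⊆ Metric.closedBall x φ.rOut := by
      intro y hy
      have h2 : x - y ∈ Function.support ρ := by
        intro h0
        exact hy (by simp [ψ, h0])
      rw [hρ, φ.support_normed_eq, mem_ball_zero_iff] at h2
      rw [Metric.mem_closedBall, dist_comm, dist_eq_norm]
      exact h2.le
    have hts : tsupport ψ ⊆ Metric.closedBall x φ.rOut :=
      closure_minimal hsub Metric.isClosed_closedBall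
    refine ⟨?_, ?_, hts.trans hx⟩
    · exact Complex.ofRealCLM.contDiff.comp (hρd.comp (contDiff_const.sub contDiff_id))
    · exact (isCompact_closedBall x φ.rOut).of_isClosed_subset (isClosed_tsupport _) hts
  have hw := h.weak ψ hψ i
  have h5 : ((Ω.indicator u) ⋆[(lsmul ℝ ℝ : ℝ →L[ℝ] ℂ →L[ℝ] ℂ).flip, volume]
      fun a => fderiv ℝ ρ a e) x = -∫ y in Ω, u y * fderiv ℝ ψ y e := by
    rw [convolution_def, ← integral_neg, ← integral_indicator hΩ]
    refine integral_congr_ae (Eventually.of_forall fun y => ?_)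
    by_cases hy : y ∈ Ω
    · simp [hy, hψd, mul_comm]
    · simp [hy]
  have h6 : (ρ ⋆[lsmul ℝ ℝ, volume] Ω.indicator fun y => g y i) x = ∫ y in Ω, g y i * ψ y := by
    rw [convolution_eq_swap, ← integral_indicator hΩ]
    refine integral_congr_ae (Eventually.of_forall fun y => ?_)
    by_cases hy : y ∈ Ω
    · simp [hy, ψ, mul_comm]
    · simp [hy]
  rw [h5, hw, neg_neg, h6]

open ContinuousLinearMap in
/-- The chain rule, in weak form, for a `C¹`-function with bounded derivative and a bounded
`H¹`-function that is continuous on `Ω`. -/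
lemma HasH1Gradient.integral_comp_mul_fderiv (hΩ : IsOpen Ω) (hΩb : Bornology.IsBounded Ω)
    {u : EuclideanSpace ℝ (Fin d) → ℂ}
    {g : EuclideanSpace ℝ (Fin d) → EuclideanSpace ℂ (Fin d)} (h : HasH1Gradient Ω u g)
    (huc : ContinuousOn u Ω) {B : ℝ} (hB : ∀ x ∈ Ω, ‖u x‖ ≤ B)
    {G : ℂ → ℂ} (hG : ContDiff ℝ 1 G) {C : ℝ} (hC : ∀ z, ‖fderiv ℝ G z‖ ≤ C)
    {φ : EuclideanSpace ℝ (Fin d) → ℂ} (hφ : IsTestFunction Ω φ) (i : Fin d) :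
    ∫ x in Ω, G (u x) * fderiv ℝ φ x (EuclideanSpace.single i 1) =
      -∫ x in Ω, fderiv ℝ G (u x) (g x i) * φ x := by
  set e : EuclideanSpace ℝ (Fin d) := EuclideanSpace.single i 1
  have : IsFiniteMeasure (volOn Ω) := ⟨by simpa using hΩb.measure_lt_top⟩
  set U := Ω.indicator u with hU
  set γ := Ω.indicator fun y => g y i with hγ
  have hUi : Integrable U :=
    (integrable_indicator_iff hΩ.measurableSet).2 (h.memLp.integrable one_le_two)
  have hγi : Integrable γ := by
    refine (integrable_indicator_iff hΩ.measurableSet).2 ?_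
    have h1 : MemLp (fun x => g x i) 2 (volOn Ω) :=
      ((EuclideanSpace.proj (𝕜 := ℂ) i).comp_memLp' h.memLp_grad)
    exact h1.integrable one_le_two
  have hUat : ∀ x ∈ Ω, ContinuousAt U x := by
    intro x hx
    refine (huc.continuousAt (hΩ.mem_nhds hx)).congr ?_
    filter_upwards [hΩ.mem_nhds hx] with y hy
    rw [hU, Set.indicator_of_mem hy]
  have hφ0 : ∀ x, x ∉ Ω → φ x = 0 := fun x hx =>
    image_eq_zero_of_notMem_tsupport fun hx' => hx (hφ.tsupport_subset hx')
  have hdφ0 : ∀ x, x ∉ Ω → fderiv ℝ φ x e = 0 := fun x hx => by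
    have : fderiv ℝ φ x = 0 := image_eq_zero_of_notMem_tsupport fun hx' =>
      hx (hφ.tsupport_subset (tsupport_fderiv_subset ℝ hx'))
    rw [this]; rfl
  have hφc : Continuous φ := hφ.contDiff.continuous
  have hφd : Differentiable ℝ φ := hφ.contDiff.differentiable (by simp)
  have hdφc : Continuous fun x => fderiv ℝ φ x e :=
    (hφ.contDiff.continuous_fderiv (by simp)).clm_apply continuous_const
  have hdφs : HasCompactSupport fun x => fderiv ℝ φ x e := hφ.hasCompactSupport.fderiv_apply ℝ e
  obtain ⟨Mφ, hMφ⟩ := hφc.bounded_above_of_compact_support hφ.hasCompactSupport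
  have hMφ0 : 0 ≤ Mφ := (norm_nonneg _).trans (hMφ 0)
  have hC0 : 0 ≤ C := (norm_nonneg _).trans (hC 0)
  let b : ℕ → ContDiffBump (0 : EuclideanSpace ℝ (Fin d)) := fun n =>
    ⟨1 / ((n : ℝ) + 1) / 2, 1 / ((n : ℝ) + 1), by positivity, half_lt_self (by positivity)⟩
  have hb : Tendsto (fun n => (b n).rOut) atTop (𝓝 0) := tendsto_one_div_add_atTop_nhds_zero_nat
  let v : ℕ → EuclideanSpace ℝ (Fin d) → ℂ := fun n =>
    (b n).normed volume ⋆[lsmul ℝ ℝ, volume] U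
  let w : ℕ → EuclideanSpace ℝ (Fin d) → ℂ := fun n =>
    (b n).normed volume ⋆[lsmul ℝ ℝ, volume] γ
  have hvd : ∀ n, ContDiff ℝ 1 (v n) := fun n =>
    (b n).hasCompactSupport_normed.contDiff_convolution_left _ (b n).contDiff_normed
      hUi.locallyIntegrable
  have hwi : ∀ n, Integrable (w n) := fun n =>
    ((b n).integrable_normed).integrable_convolution _ hγi
  have hvt : ∀ x ∈ Ω, Tendsto (fun n => v n x) atTop (𝓝 (U x)) := fun x hx =>
    ContDiffBump.convolution_tendsto_right hb
      (Eventually.of_forall fun _ => hUi.aestronglyMeasurable)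
      ((hUat x hx).tendsto.comp tendsto_snd) tendsto_const_nhds
  obtain ⟨δ, hδ, hδΩ⟩ := hφ.hasCompactSupport.isCompact.exists_cthickening_subset_open hΩ
    hφ.tsupport_subset
  -- Mollifying the extension by zero respects the gradient only away from the boundary; for large n
  -- this covers the support of φ, the only place where it is used.
  have hvw : ∀ᶠ n in atTop, ∀ x ∈ tsupport φ, fderiv ℝ (v n) x e = w n x := by
    filter_upwards [hb.eventually_lt_const hδ] with n hn x hx
    refine h.fderiv_normed_convolution hΩ.measurableSet hUi.locallyIntegrable (b n) ?_ i
    exact ((Metric.closedBall_subset_closedBall hn.le).trans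
      (Metric.closedBall_subset_cthickening hx δ)).trans hδΩ
  have hUB : ∀ x, ‖U x‖ ≤ max B 0 := by
    intro x
    by_cases hx : x ∈ Ω
    · rw [hU, Set.indicator_of_mem hx]; exact (hB x hx).trans (le_max_left _ _)
    · rw [hU, Set.indicator_of_notMem hx, norm_zero]; exact le_max_right _ _
  have hvB : ∀ n x, ‖v n x‖ ≤ 3 * max B 0 := by
    intro n x
    have h1 : dist (v n x) (U x) ≤ 2 * max B 0 := by
      refine ContDiffBump.dist_normed_convolution_le hUi.aestronglyMeasurable fun y _ => ?_
      have := dist_le_norm_add_norm (U y) (U x)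
      linarith [hUB x, hUB y]
    have h2 : ‖v n x‖ ≤ dist (v n x) (U x) + ‖U x‖ := by
      rw [dist_eq_norm]; simpa using norm_add_le (v n x - U x) (U x)
    linarith [hUB x]
  have hGL : ∀ z, ‖G z‖ ≤ ‖G 0‖ + C * ‖z‖ := by
    intro z
    have h1 := Convex.norm_image_sub_le_of_norm_fderiv_le (𝕜 := ℝ) (f := G) (C := C)
      (fun x _ => (hG.differentiable one_ne_zero) x) (fun x _ => hC x) convex_univ
      (Set.mem_univ 0) (Set.mem_univ z)
    rw [sub_zero] at h1
    have h2 : ‖G z‖ ≤ ‖G z - G 0‖ + ‖G 0‖ := by simpa using norm_add_le (G z - G 0) (G 0)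
    linarith
  have hDGc : Continuous (fderiv ℝ G) := hG.continuous_fderiv one_ne_zero
  have hparts : ∀ᶠ n in atTop, ∫ x, G (v n x) * fderiv ℝ φ x e =
      -∫ x, fderiv ℝ G (v n x) (w n x) * φ x := by
    filter_upwards [hvw] with n hn
    have hGv : ContDiff ℝ 1 (fun x => G (v n x)) := hG.comp (hvd n)
    have hdG : ∀ x, fderiv ℝ (fun x => G (v n x)) x e = fderiv ℝ G (v n x) (fderiv ℝ (v n) x e) :=
      fun x => by
        have := ((hG.differentiable one_ne_zero) (v n x)).hasFDerivAt.comp x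
          ((hvd n).differentiable one_ne_zero x).hasFDerivAt
        rw [show fderiv ℝ (fun x => G (v n x)) x = _ from this.fderiv]
        rfl
    have hc1 : Continuous fun x => fderiv ℝ (fun x => G (v n x)) x e :=
      (hGv.continuous_fderiv one_ne_zero).clm_apply continuous_const
    rw [integral_mul_fderiv_eq_neg_fderiv_mul_of_integrable
      ((hc1.mul hφc).integrable_of_hasCompactSupport hφ.hasCompactSupport.mul_left)
      ((hGv.continuous.mul hdφc).integrable_of_hasCompactSupport hdφs.mul_left)
      ((hGv.continuous.mul hφc).integrable_of_hasCompactSupport hφ.hasCompactSupport.mul_left)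
      (fun x _ => hGv.differentiable one_ne_zero x) (fun x _ => hφd x)]
    congr 1
    refine integral_congr_ae (Eventually.of_forall fun x => ?_)
    by_cases hx : x ∈ tsupport φ
    · simp only [hdG, hn x hx]
    · simp [image_eq_zero_of_notMem_tsupport hx]
  have hlim1 : Tendsto (fun n => ∫ x, G (v n x) * fderiv ℝ φ x e) atTop
      (𝓝 (∫ x, G (U x) * fderiv ℝ φ x e)) := by
    refine tendsto_integral_of_dominated_convergence
      (fun x => (‖G 0‖ + C * (3 * max B 0)) * ‖fderiv ℝ φ x e‖)
      (fun n => ((hG.continuous.comp (hvd n).continuous).mul hdφc).aestronglyMeasurable)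
      ((hdφc.integrable_of_hasCompactSupport hdφs).norm.const_mul _)
      (fun n => Eventually.of_forall fun x => ?_) (Eventually.of_forall fun x => ?_)
    · rw [norm_mul]
      gcongr
      exact (hGL _).trans (by gcongr; exact hvB n x)
    · by_cases hx : x ∈ Ω
      · exact ((hG.continuous.tendsto _).comp (hvt x hx)).mul_const _
      · simp only [hdφ0 x hx, mul_zero, tendsto_const_nhds]
  have hDGm : ∀ {f k : EuclideanSpace ℝ (Fin d) → ℂ}, AEStronglyMeasurable f volume →
      AEStronglyMeasurable k volume →
      AEStronglyMeasurable (fun x => fderiv ℝ G (f x) (k x) * φ x) volume := fun hf hk =>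
    (isBoundedBilinearMap_apply.continuous.comp_aestronglyMeasurable
      ((hDGc.comp_aestronglyMeasurable hf).prodMk hk)).mul hφc.aestronglyMeasurable
  have hDGb : ∀ z ζ x, ‖fderiv ℝ G z ζ * φ x‖ ≤ C * Mφ * ‖ζ‖ := by
    intro z ζ x
    rw [norm_mul, mul_right_comm]
    gcongr
    · exact (fderiv ℝ G z).le_of_opNorm_le (hC z) ζ
    · exact hMφ x
  have hDGi : ∀ {f k : EuclideanSpace ℝ (Fin d) → ℂ}, AEStronglyMeasurable f volume →
      Integrable k → Integrable (fun x => fderiv ℝ G (f x) (k x) * φ x) volume := fun hf hk =>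
    (hk.norm.const_mul (C * Mφ)).mono' (hDGm hf hk.aestronglyMeasurable)
      (Eventually.of_forall fun x => hDGb _ _ _)
  -- Continuity of u gives v_n → u at every point of Ω, but w_n → γ is available only in L¹. The
  -- limit is therefore taken with γ frozen, and the error is controlled by the bound on DG.
  have hlim2 : Tendsto (fun n => ∫ x, fderiv ℝ G (v n x) (γ x) * φ x) atTop
      (𝓝 (∫ x, fderiv ℝ G (U x) (γ x) * φ x)) := by
    refine tendsto_integral_of_dominated_convergence (fun x => C * Mφ * ‖γ x‖)
      (fun n => hDGm (hvd n).continuous.aestronglyMeasurable hγi.aestronglyMeasurable)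
      (hγi.norm.const_mul _) (fun n => Eventually.of_forall fun x => hDGb _ _ _)
      (Eventually.of_forall fun x => ?_)
    by_cases hx : x ∈ Ω
    · exact (((hDGc.clm_apply (continuous_const (y := γ x))).tendsto _).comp (hvt x hx)).mul_const _
    · simp only [hφ0 x hx, mul_zero, tendsto_const_nhds]
  have hlim3 : Tendsto (fun n => ∫ x, fderiv ℝ G (v n x) (w n x) * φ x -
      fderiv ℝ G (v n x) (γ x) * φ x) atTop (𝓝 0) := by
    have h1 := (tendsto_integral_norm_convolution_sub hb hγi).const_mul (C * Mφ)
    rw [mul_zero] at h1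
    refine squeeze_zero_norm (fun n => ?_) h1
    rw [← integral_const_mul]
    refine norm_integral_le_of_norm_le (((hwi n).sub hγi).norm.const_mul _)
      (Eventually.of_forall fun x => ?_)
    rw [← sub_mul, ← map_sub]
    exact hDGb _ _ _
  have hlim4 : Tendsto (fun n => ∫ x, fderiv ℝ G (v n x) (w n x) * φ x) atTop
      (𝓝 (∫ x, fderiv ℝ G (U x) (γ x) * φ x)) := by
    have h1 := hlim3.add hlim2
    rw [zero_add] at h1
    refine h1.congr fun n => ?_
    have hm := (hvd n).continuous.aestronglyMeasurable (μ := (volume :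
      Measure (EuclideanSpace ℝ (Fin d))))
    rw [integral_sub (hDGi hm (hwi n)) (hDGi hm hγi), sub_add_cancel]
  have hfin := tendsto_nhds_unique (hlim1.congr' hparts) hlim4.neg
  have e1 : ∫ x in Ω, G (u x) * fderiv ℝ φ x e = ∫ x, G (U x) * fderiv ℝ φ x e := by
    rw [← integral_indicator hΩ.measurableSet]
    refine integral_congr_ae (Eventually.of_forall fun x => ?_)
    by_cases hx : x ∈ Ω
    · simp [hx, hU]
    · simp [hx, hdφ0 x hx]
  have e2 : ∫ x in Ω, fderiv ℝ G (u x) (g x i) * φ x = ∫ x, fderiv ℝ G (U x) (γ x) * φ x := by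
    rw [← integral_indicator hΩ.measurableSet]
    refine integral_congr_ae (Eventually.of_forall fun x => ?_)
    by_cases hx : x ∈ Ω
    · simp [hx, hU, hγ]
    · simp [hx, hφ0 x hx]
  rw [e1, e2, hfin]

end ChainRule

/-! ### Calculus of weak gradients -/

section WeakGradient

variable {d : ℕ} {Ω : Set (EuclideanSpace ℝ (Fin d))}

lemma isFiniteMeasure_volOn (hΩb : Bornology.IsBounded Ω) : IsFiniteMeasure (volOn Ω) :=
  ⟨by simpa using hΩb.measure_lt_top⟩

lemma IsTestFunction.memLp {φ : EuclideanSpace ℝ (Fin d) → ℂ} (hφ : IsTestFunction Ω φ) :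
    MemLp φ 2 (volOn Ω) :=
  hφ.contDiff.continuous.memLp_of_hasCompactSupport hφ.hasCompactSupport

lemma IsTestFunction.fderiv_apply {φ : EuclideanSpace ℝ (Fin d) → ℂ} (hφ : IsTestFunction Ω φ)
    (e : EuclideanSpace ℝ (Fin d)) : IsTestFunction Ω fun x => fderiv ℝ φ x e where
  contDiff := (hφ.contDiff.fderiv_right (m := ((⊤ : ℕ∞) : WithTop ℕ∞)) (by simp)).clm_apply
    contDiff_const
  hasCompactSupport := hφ.hasCompactSupport.fderiv_apply ℝ e
  tsupport_subset := (tsupport_fderiv_apply_subset ℝ e).trans hφ.tsupport_subset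

lemma IsTestFunction.conj {φ : EuclideanSpace ℝ (Fin d) → ℂ} (hφ : IsTestFunction Ω φ) :
    IsTestFunction Ω fun x => conj (φ x) where
  contDiff := Complex.conjCLE.contDiff.comp hφ.contDiff
  hasCompactSupport := hφ.hasCompactSupport.comp_left (map_zero _)
  tsupport_subset := (closure_mono (Function.support_subset_iff'.2 fun x hx => by
    simp [Function.notMem_support.1 hx])).trans hφ.tsupport_subset

lemma isTestFunction_ofReal {φ : EuclideanSpace ℝ (Fin d) → ℝ}
    (h1 : ContDiff ℝ ((⊤ : ℕ∞) : WithTop ℕ∞) φ) (h2 : HasCompactSupport φ) (h3 : tsupport φ ⊆ Ω) :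
    IsTestFunction Ω fun x => (φ x : ℂ) where
  contDiff := Complex.ofRealCLM.contDiff.comp h1
  hasCompactSupport := h2.comp_left Complex.ofReal_zero
  tsupport_subset := (closure_mono (Function.support_subset_iff'.2 fun x hx => by
    simp [Function.notMem_support.1 hx])).trans h3

lemma HasH1Gradient.congr {u u' : EuclideanSpace ℝ (Fin d) → ℂ}
    {g g' : EuclideanSpace ℝ (Fin d) → EuclideanSpace ℂ (Fin d)} (h : HasH1Gradient Ω u g)
    (hu : u =ᵐ[volOn Ω] u') (hg : g =ᵐ[volOn Ω] g') : HasH1Gradient Ω u' g' where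
  memLp := h.memLp.ae_eq hu
  memLp_grad := h.memLp_grad.ae_eq hg
  weak φ hφ i := by
    refine Eq.trans (integral_congr_ae ?_) ((h.weak φ hφ i).trans
      (congrArg Neg.neg (integral_congr_ae ?_)))
    · filter_upwards [hu] with x hx
      rw [hx]
    · filter_upwards [hg] with x hx
      rw [hx]

lemma MemLp.euclidean_apply {μ : Measure (EuclideanSpace ℝ (Fin d))}
    {g : EuclideanSpace ℝ (Fin d) → EuclideanSpace ℂ (Fin d)} (hg : MemLp g 2 μ) (i : Fin d) :
    MemLp (fun x => g x i) 2 μ :=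
  (EuclideanSpace.proj (𝕜 := ℂ) i).comp_memLp' hg

lemma integrable_mul_of_memLp {μ : Measure (EuclideanSpace ℝ (Fin d))}
    {f g : EuclideanSpace ℝ (Fin d) → ℂ} (hf : MemLp f 2 μ) (hg : MemLp g 2 μ) :
    Integrable (fun x => f x * g x) μ :=
  hf.integrable_mul hg

lemma memLp_toLp {μ : Measure (EuclideanSpace ℝ (Fin d))}
    {g : Fin d → EuclideanSpace ℝ (Fin d) → ℂ} (hg : ∀ i, MemLp (g i) 2 μ) :
    MemLp (fun x => WithLp.toLp 2 fun i => g i x : EuclideanSpace ℝ (Fin d) →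
      EuclideanSpace ℂ (Fin d)) 2 μ :=
  (PiLp.continuousLinearEquiv 2 ℂ fun _ : Fin d => ℂ).symm.toContinuousLinearMap.comp_memLp'
    (memLp_pi_iff.2 hg)

lemma HasH1Gradient.add {u u' : EuclideanSpace ℝ (Fin d) → ℂ}
    {g g' : EuclideanSpace ℝ (Fin d) → EuclideanSpace ℂ (Fin d)} (h : HasH1Gradient Ω u g)
    (h' : HasH1Gradient Ω u' g') : HasH1Gradient Ω (u + u') (g + g') where
  memLp := h.memLp.add h'.memLp
  memLp_grad := h.memLp_grad.add h'.memLp_grad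
  weak φ hφ i := by
    have hd := (hφ.fderiv_apply (EuclideanSpace.single i 1)).memLp
    simp only [Pi.add_apply, PiLp.add_apply, add_mul]
    rw [integral_add (integrable_mul_of_memLp h.memLp hd) (integrable_mul_of_memLp h'.memLp hd),
      integral_add (integrable_mul_of_memLp (MemLp.euclidean_apply h.memLp_grad i) hφ.memLp)
        (integrable_mul_of_memLp (MemLp.euclidean_apply h'.memLp_grad i) hφ.memLp),
      h.weak φ hφ i, h'.weak φ hφ i, neg_add]

lemma HasH1Gradient.smul (c : ℂ) {u : EuclideanSpace ℝ (Fin d) → ℂ}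
    {g : EuclideanSpace ℝ (Fin d) → EuclideanSpace ℂ (Fin d)} (h : HasH1Gradient Ω u g) :
    HasH1Gradient Ω (c • u) (c • g) where
  memLp := h.memLp.const_smul c
  memLp_grad := h.memLp_grad.const_smul c
  weak φ hφ i := by
    simp only [Pi.smul_apply, PiLp.smul_apply, smul_eq_mul, mul_assoc]
    rw [integral_const_mul, integral_const_mul, h.weak φ hφ i, mul_neg]

lemma memLp_of_continuousOn {F : Type*} [NormedAddCommGroup F]
    {K : Set (EuclideanSpace ℝ (Fin d))} (hK : IsCompact K) {s : Set (EuclideanSpace ℝ (Fin d))}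
    (hs : MeasurableSet s) (hsK : s ⊆ K) {μ : Measure (EuclideanSpace ℝ (Fin d))}
    [IsFiniteMeasure (μ.restrict s)] [SecondCountableTopology F]
    {f : EuclideanSpace ℝ (Fin d) → F} (hf : ContinuousOn f K) : MemLp f 2 (μ.restrict s) := by
  obtain ⟨C, hC⟩ := hK.exists_bound_of_continuousOn hf
  exact MemLp.of_bound ((hf.mono hsK).aestronglyMeasurable hs) C
    ((ae_restrict_mem hs).mono fun x hx => hC x (hsK hx))

/-- A function of class `C¹` on the whole space restricts to an element of `H¹(Ω)`. -/
lemma hasH1Gradient_of_contDiff (hΩ : IsOpen Ω) (hΩb : Bornology.IsBounded Ω)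
    {f : EuclideanSpace ℝ (Fin d) → ℂ} (hf : ContDiff ℝ 1 f) :
    HasH1Gradient Ω f fun x => WithLp.toLp 2 fun i => fderiv ℝ f x (EuclideanSpace.single i 1) := by
  have := isFiniteMeasure_volOn hΩb
  have hK := hΩb.isCompact_closure
  have hdc : ∀ i : Fin d, Continuous fun x => fderiv ℝ f x (EuclideanSpace.single i 1) := fun i =>
    (hf.continuous_fderiv one_ne_zero).clm_apply continuous_const
  refine ⟨memLp_of_continuousOn hK hΩ.measurableSet subset_closure hf.continuous.continuousOn,
    memLp_toLp fun i => memLp_of_continuousOn hK hΩ.measurableSet subset_closure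
      (hdc i).continuousOn, fun φ hφ i => ?_⟩
  have hφc := hφ.contDiff.continuous
  have hd := hφ.fderiv_apply (EuclideanSpace.single i 1)
  rw [setIntegral_eq_integral_of_forall_compl_eq_zero,
    setIntegral_eq_integral_of_forall_compl_eq_zero]
  · exact integral_mul_fderiv_eq_neg_fderiv_mul_of_integrable
      (((hdc i).mul hφc).integrable_of_hasCompactSupport hφ.hasCompactSupport.mul_left)
      ((hf.continuous.mul hd.contDiff.continuous).integrable_of_hasCompactSupport
        hd.hasCompactSupport.mul_left)
      ((hf.continuous.mul hφc).integrable_of_hasCompactSupport hφ.hasCompactSupport.mul_left)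
      (fun x _ => hf.differentiable one_ne_zero x)
      (fun x _ => hφ.contDiff.differentiable (by simp) x)
  · intro x hx
    rw [image_eq_zero_of_notMem_tsupport fun h => hx (hφ.tsupport_subset h), mul_zero]
  · intro x hx
    rw [image_eq_zero_of_notMem_tsupport
      (f := fun x => fderiv ℝ φ x (EuclideanSpace.single i 1)) fun h => hx (hd.tsupport_subset h),
      mul_zero]

/-- A function in `L²(Ω)` that is orthogonal to all test functions vanishes. -/
lemma ae_eq_zero_of_integral_test (hΩ : IsOpen Ω) {f : EuclideanSpace ℝ (Fin d) → ℂ}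
    (hf : MemLp f 2 (volOn Ω))
    (h : ∀ φ, IsTestFunction Ω φ → ∫ x in Ω, f x * φ x = 0) : f =ᵐ[volOn Ω] 0 := by
  have hloc : LocallyIntegrableOn f Ω :=
    (hf.locallyIntegrable one_le_two).locallyIntegrableOn Ω |> fun h' => by
      rw [locallyIntegrableOn_iff hΩ.isLocallyClosed] at h' ⊢
      intro k hk hkc
      have := h' k hk hkc
      rwa [IntegrableOn, Measure.restrict_restrict_of_subset hk] at this
  have h1 := hΩ.ae_eq_zero_of_integral_contDiff_smul_eq_zero hloc fun φ h1 h2 h3 => by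
    rw [← h _ (isTestFunction_ofReal h1 h2 h3), setIntegral_eq_integral_of_forall_compl_eq_zero]
    · refine integral_congr_ae (Eventually.of_forall fun x => ?_)
      simp [mul_comm]
    · intro x hx
      rw [image_eq_zero_of_notMem_tsupport fun h => hx (h3 h)]
      simp
  exact (ae_restrict_iff' hΩ.measurableSet).2 h1

lemma HasH1Gradient.ae_eq (hΩ : IsOpen Ω) {u u' : EuclideanSpace ℝ (Fin d) → ℂ}
    {g g' : EuclideanSpace ℝ (Fin d) → EuclideanSpace ℂ (Fin d)} (h : HasH1Gradient Ω u g)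
    (h' : HasH1Gradient Ω u' g') (hu : u =ᵐ[volOn Ω] u') : g =ᵐ[volOn Ω] g' := by
  have h2 := h.congr hu EventuallyEq.rfl
  have key : ∀ i, (fun x => g x i - g' x i) =ᵐ[volOn Ω] 0 := by
    intro i
    have m1 := MemLp.euclidean_apply h.memLp_grad i
    have m2 := MemLp.euclidean_apply h'.memLp_grad i
    refine ae_eq_zero_of_integral_test hΩ (m1.sub m2) fun φ hφ => ?_
    simp only [sub_mul]
    rw [integral_sub (integrable_mul_of_memLp m1 hφ.memLp) (integrable_mul_of_memLp m2 hφ.memLp),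
      sub_eq_zero,
      ← neg_inj, ← h2.weak φ hφ i, ← h'.weak φ hφ i]
  filter_upwards [ae_all_iff.2 key] with x hx
  ext i
  exact sub_eq_zero.1 (hx i)

lemma HasL2Laplacian.ae_eq (hΩ : IsOpen Ω) {u f f' : EuclideanSpace ℝ (Fin d) → ℂ}
    (h : HasL2Laplacian Ω u f) (h' : HasL2Laplacian Ω u f') : f =ᵐ[volOn Ω] f' := by
  have key : (fun x => f x - f' x) =ᵐ[volOn Ω] 0 := by
    refine ae_eq_zero_of_integral_test hΩ (h.memLp.sub h'.memLp) fun φ hφ => ?_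
    simp only [sub_mul]
    rw [integral_sub (integrable_mul_of_memLp h.memLp hφ.memLp)
      (integrable_mul_of_memLp h'.memLp hφ.memLp),
      sub_eq_zero, ← h.weak φ hφ, ← h'.weak φ hφ]
  filter_upwards [key] with x hx
  exact sub_eq_zero.1 hx

/-- The chain rule for continuous `H¹`-functions. -/
lemma HasH1Gradient.comp (hΩ : IsOpen Ω) (hΩb : Bornology.IsBounded Ω)
    {u : EuclideanSpace ℝ (Fin d) → ℂ}
    {g : EuclideanSpace ℝ (Fin d) → EuclideanSpace ℂ (Fin d)} (h : HasH1Gradient Ω u g)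
    (huc : ContinuousOn u (closure Ω)) {G : ℂ → ℂ} (hG : ContDiff ℝ 1 G) {C : ℝ}
    (hC : ∀ z, ‖fderiv ℝ G z‖ ≤ C) :
    HasH1Gradient Ω (fun x => G (u x))
      (fun x => WithLp.toLp 2 fun i => fderiv ℝ G (u x) (g x i)) := by
  have := isFiniteMeasure_volOn hΩb
  have hK := hΩb.isCompact_closure
  obtain ⟨B, hB⟩ := hK.exists_bound_of_continuousOn huc
  refine ⟨memLp_of_continuousOn hK hΩ.measurableSet subset_closure
    (hG.continuous.comp_continuousOn huc), memLp_toLp fun i => ?_, fun φ hφ i =>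
      h.integral_comp_mul_fderiv hΩ hΩb (huc.mono subset_closure)
        (fun x hx => hB x (subset_closure hx)) hG hC hφ i⟩
  have m := MemLp.euclidean_apply h.memLp_grad i
  refine MemLp.of_le_mul (c := C) m ?_ (Eventually.of_forall fun x =>
    (fderiv ℝ G (u x)).le_of_opNorm_le (hC _) _)
  exact isBoundedBilinearMap_apply.continuous.comp_aestronglyMeasurable
    (((hG.continuous_fderiv one_ne_zero).comp_aestronglyMeasurable
      h.memLp.aestronglyMeasurable).prodMk m.aestronglyMeasurable)

lemma inner_Lp_eq_integral {F : Type*} [NormedAddCommGroup F] [InnerProductSpace ℂ F]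
    {μ : Measure (EuclideanSpace ℝ (Fin d))} {k q : Lp F 2 μ}
    {v w : EuclideanSpace ℝ (Fin d) → F} (hv : k =ᵐ[μ] v) (hw : q =ᵐ[μ] w) :
    inner ℂ k q = ∫ x, inner ℂ (v x) (w x) ∂μ := by
  rw [L2.inner_def]
  refine integral_congr_ae ?_
  filter_upwards [hv, hw] with x h1 h2
  rw [h1, h2]

/-- The weak gradient is a closed operator. -/
lemma isClosed_hasH1Gradient (Ω : Set (EuclideanSpace ℝ (Fin d))) :
    IsClosed {p : Lp ℂ 2 (volOn Ω) × Lp (EuclideanSpace ℂ (Fin d)) 2 (volOn Ω) |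
      HasH1Gradient Ω p.1 p.2} := by
  -- Each integration by parts is an equation between inner products with fixed L² elements, hence a
  -- closed condition.
  have e : {p : Lp ℂ 2 (volOn Ω) × Lp (EuclideanSpace ℂ (Fin d)) 2 (volOn Ω) |
      HasH1Gradient Ω p.1 p.2} = ⋂ φ, ⋂ (_ : IsTestFunction Ω φ), ⋂ i : Fin d,
      {p | ∫ x in Ω, p.1 x * fderiv ℝ φ x (EuclideanSpace.single i 1) =
        -∫ x in Ω, p.2 x i * φ x} := by
    ext p
    simp only [Set.mem_ofPred_eq, Set.mem_iInter]
    exact ⟨fun h => h.weak, fun h => ⟨Lp.memLp _, Lp.memLp _, h⟩⟩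
  rw [e]
  refine isClosed_iInter fun φ => isClosed_iInter fun hφ => isClosed_iInter fun i => ?_
  have hd := (hφ.fderiv_apply (EuclideanSpace.single i 1)).conj.memLp
  have hs : MemLp (fun x => EuclideanSpace.single i (conj (φ x)) : EuclideanSpace ℝ (Fin d) →
      EuclideanSpace ℂ (Fin d)) 2 (volOn Ω) := by
    refine MemLp.of_le_mul (c := 1) hφ.conj.memLp ?_ (Eventually.of_forall fun x => by simp)
    have : Continuous fun z : ℂ => (EuclideanSpace.single i z : EuclideanSpace ℂ (Fin d)) :=
      (PiLp.continuous_toLp 2 fun _ : Fin d => ℂ).comp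
        (continuous_single (A := fun _ : Fin d => ℂ) i)
    exact this.comp_aestronglyMeasurable hφ.conj.memLp.aestronglyMeasurable
  have e1 : ∀ p : Lp ℂ 2 (volOn Ω) × Lp (EuclideanSpace ℂ (Fin d)) 2 (volOn Ω),
      ∫ x in Ω, p.1 x * fderiv ℝ φ x (EuclideanSpace.single i 1) =
        inner ℂ (hd.toLp _) p.1 := fun p => by
    rw [inner_Lp_eq_integral hd.coeFn_toLp EventuallyEq.rfl]
    simp
  have e2 : ∀ p : Lp ℂ 2 (volOn Ω) × Lp (EuclideanSpace ℂ (Fin d)) 2 (volOn Ω),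
      ∫ x in Ω, p.2 x i * φ x = inner ℂ (hs.toLp _) p.2 := fun p => by
    rw [inner_Lp_eq_integral hs.coeFn_toLp EventuallyEq.rfl]
    simp [EuclideanSpace.inner_single_left, mul_comm]
  simp only [e1, e2]
  exact isClosed_eq (continuous_const.inner continuous_fst)
    (continuous_const.inner continuous_snd).neg

end WeakGradient

/-! ### The form domain and approximative traces -/

section FormDomain

variable {d : ℕ} {Ω : Set (EuclideanSpace ℝ (Fin d))}

/-- The Hilbert space `L²(Ω) ⊕ L²(Γ) ⊕ L²(Ω; ℂᵈ)`, home of the triples `(u, ψ, ∇u)`. -/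
abbrev GradSpace (Ω : Set (EuclideanSpace ℝ (Fin d))) : Type :=
  WithLp 2 (L2Sum Ω × Lp (EuclideanSpace ℂ (Fin d)) 2 (volOn Ω))

/-- `k` is the triple `(v, v|_Γ, ∇v)` with `v ∈ C(closure Ω) ∩ H¹(Ω)` and `∇v = gv`. -/
structure Represents (k : GradSpace Ω) (v : EuclideanSpace ℝ (Fin d) → ℂ)
    (gv : EuclideanSpace ℝ (Fin d) → EuclideanSpace ℂ (Fin d)) : Prop where
  continuousOn : ContinuousOn v (closure Ω)
  hasH1Gradient : HasH1Gradient Ω v gv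
  fst_fst : k.fst.fst =ᵐ[volOn Ω] v
  fst_snd : k.fst.snd =ᵐ[surfOn Ω] v
  snd : k.snd =ᵐ[volOn Ω] gv

/-- The triples `(v, v|_Γ, ∇v)` with `v ∈ C(closure Ω) ∩ H¹(Ω)`. -/
def contH1 (Ω : Set (EuclideanSpace ℝ (Fin d))) : Submodule ℂ (GradSpace Ω) where
  carrier := {k | ∃ v gv, Represents k v gv}
  add_mem' := by
    rintro k k' ⟨v, gv, h⟩ ⟨v', gv', h'⟩
    exact ⟨v + v', gv + gv', h.continuousOn.add h'.continuousOn,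
      h.hasH1Gradient.add h'.hasH1Gradient,
      (Lp.coeFn_add _ _).trans (h.fst_fst.add h'.fst_fst),
      (Lp.coeFn_add _ _).trans (h.fst_snd.add h'.fst_snd),
      (Lp.coeFn_add _ _).trans (h.snd.add h'.snd)⟩
  zero_mem' := by
    refine ⟨0, 0, continuousOn_const, ⟨MemLp.zero, MemLp.zero, fun φ _ i => ?_⟩,
      Lp.coeFn_zero _ _ _, Lp.coeFn_zero _ _ _, Lp.coeFn_zero _ _ _⟩
    simp
  smul_mem' := by
    rintro c k ⟨v, gv, h⟩
    exact ⟨c • v, c • gv, h.continuousOn.const_smul c, h.hasH1Gradient.smul c,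
      (Lp.coeFn_smul _ _).trans (h.fst_fst.const_smul c),
      (Lp.coeFn_smul _ _).trans (h.fst_snd.const_smul c),
      (Lp.coeFn_smul _ _).trans (h.snd.const_smul c)⟩

/-- The form domain `{(u, ψ, ∇u) : u ∈ H¹(Ω), ψ ∈ Tr(u)}`. -/
def formDomain (Ω : Set (EuclideanSpace ℝ (Fin d))) : Submodule ℂ (GradSpace Ω) :=
  (contH1 Ω).topologicalClosure

lemma contH1_le_formDomain : contH1 Ω ≤ formDomain Ω := Submodule.le_topologicalClosure _

lemma isClosed_formDomain : IsClosed (formDomain Ω : Set (GradSpace Ω)) :=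
  Submodule.isClosed_topologicalClosure _

lemma Represents.mem_formDomain {k : GradSpace Ω} {v : EuclideanSpace ℝ (Fin d) → ℂ}
    {gv : EuclideanSpace ℝ (Fin d) → EuclideanSpace ℂ (Fin d)} (h : Represents k v gv) :
    k ∈ formDomain Ω :=
  contH1_le_formDomain ⟨v, gv, h⟩

lemma memLp_surfOn [IsFiniteMeasure (surfOn Ω)] (hΩb : Bornology.IsBounded Ω)
    {v : EuclideanSpace ℝ (Fin d) → ℂ} (hv : ContinuousOn v (closure Ω)) :
    MemLp v 2 (surfOn Ω) :=
  memLp_of_continuousOn hΩb.isCompact_closure isClosed_frontier.measurableSet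
    frontier_subset_closure hv

lemma exists_represents [IsFiniteMeasure (surfOn Ω)] (hΩb : Bornology.IsBounded Ω)
    {v : EuclideanSpace ℝ (Fin d) → ℂ}
    {gv : EuclideanSpace ℝ (Fin d) → EuclideanSpace ℂ (Fin d)}
    (hv : ContinuousOn v (closure Ω)) (h : HasH1Gradient Ω v gv) :
    ∃ k : GradSpace Ω, Represents k v gv :=
  ⟨WithLp.toLp 2 (WithLp.toLp 2 (h.memLp.toLp v, (memLp_surfOn hΩb hv).toLp v),
    h.memLp_grad.toLp gv), hv, h, h.memLp.coeFn_toLp, (memLp_surfOn hΩb hv).coeFn_toLp,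
    h.memLp_grad.coeFn_toLp⟩

lemma inner_L2Sum_eq (p q : L2Sum Ω) :
    inner ℂ p q = inner ℂ p.fst q.fst + inner ℂ p.snd q.snd :=
  WithLp.prod_inner_apply p q

/-- Closedness of the weak gradient passes to the closure, so the last component is determined by
the first. -/
lemma hasH1Gradient_of_mem_formDomain {k : GradSpace Ω} (hk : k ∈ formDomain Ω) :
    HasH1Gradient Ω k.fst.fst k.snd := by
  have hc : Continuous fun k : GradSpace Ω => (k.fst.fst, k.snd) := by fun_prop
  have hcl := (isClosed_hasH1Gradient Ω).preimage hc
  refine hcl.closure_subset_iff.2 ?_ hk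
  rintro k ⟨v, gv, h⟩
  exact h.hasH1Gradient.congr h.fst_fst.symm h.snd.symm

lemma isTrace_of_mem_formDomain {k : GradSpace Ω} (hk : k ∈ formDomain Ω) :
    IsTrace Ω k.fst.fst k.fst.snd := by
  refine ⟨Lp.memLp _, k.snd, hasH1Gradient_of_mem_formDomain hk, ?_⟩
  obtain ⟨kn, hkn, hlim⟩ := mem_closure_iff_seq_limit.1 hk
  choose un gn h using hkn
  refine ⟨un, gn, fun n => (h n).continuousOn, fun n => (h n).hasH1Gradient, ?_, ?_, ?_⟩
  · have hc : Continuous fun k : GradSpace Ω => k.fst.fst := by fun_prop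
    have := (Lp.tendsto_Lp_iff_tendsto_eLpNorm' _ _).1 ((hc.tendsto k).comp hlim)
    refine this.congr fun n => eLpNorm_congr_ae ((h n).fst_fst.sub EventuallyEq.rfl)
  · have hc : Continuous fun k : GradSpace Ω => k.snd := by fun_prop
    have := (Lp.tendsto_Lp_iff_tendsto_eLpNorm' _ _).1 ((hc.tendsto k).comp hlim)
    refine this.congr fun n => eLpNorm_congr_ae ((h n).snd.sub EventuallyEq.rfl)
  · have hc : Continuous fun k : GradSpace Ω => k.fst.snd := by fun_prop
    have := (Lp.tendsto_Lp_iff_tendsto_eLpNorm' _ _).1 ((hc.tendsto k).comp hlim)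
    refine this.congr fun n => eLpNorm_congr_ae ((h n).fst_snd.sub EventuallyEq.rfl)

/-- The three convergences defining an approximative trace are convergence of the triples (u_n,
u_n|_Γ, ∇u_n). With `isTrace_of_mem_formDomain`, this identifies the closure with the pairs (u, ψ),
ψ ∈ Tr(u). -/
lemma exists_mem_formDomain_of_isTrace [IsFiniteMeasure (surfOn Ω)]
    (hΩb : Bornology.IsBounded Ω) {p : L2Sum Ω} (h : IsTrace Ω p.fst p.snd) :
    ∃ k ∈ formDomain Ω, k.fst = p := by
  obtain ⟨-, g, hg, un, gn, huc, hug, h1, h2, h3⟩ := h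
  choose kn hkn using fun n => exists_represents hΩb (huc n) (hug n)
  refine ⟨WithLp.toLp 2 (p, hg.memLp_grad.toLp g), ?_, rfl⟩
  refine mem_closure_of_tendsto (f := kn) (b := atTop) ?_
    (Eventually.of_forall fun n => ⟨_, _, hkn n⟩)
  have t1 : Tendsto (fun n => (kn n).fst.fst) atTop (𝓝 p.fst) :=
    (Lp.tendsto_Lp_iff_tendsto_eLpNorm' _ _).2 (h1.congr fun n =>
      eLpNorm_congr_ae ((hkn n).fst_fst.symm.sub EventuallyEq.rfl))
  have t2 : Tendsto (fun n => (kn n).fst.snd) atTop (𝓝 p.snd) :=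
    (Lp.tendsto_Lp_iff_tendsto_eLpNorm' _ _).2 (h3.congr fun n =>
      eLpNorm_congr_ae ((hkn n).fst_snd.symm.sub EventuallyEq.rfl))
  have t3 : Tendsto (fun n => (kn n).snd) atTop (𝓝 (hg.memLp_grad.toLp g)) :=
    (Lp.tendsto_Lp_iff_tendsto_eLpNorm' _ _).2 (h2.congr fun n =>
      eLpNorm_congr_ae ((hkn n).snd.symm.sub hg.memLp_grad.coeFn_toLp.symm))
  have t4 := (WithLp.prod_continuous_toLp 2 _ _).tendsto _ |>.comp (t1.prodMk_nhds t2)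
  exact (WithLp.prod_continuous_toLp 2 _ _).tendsto _ |>.comp (t4.prodMk_nhds t3)

/-- The inner products with `(v, v|_Γ, ∇v)`, written as integrals. -/
lemma Represents.inner_eq {k : GradSpace Ω} {v : EuclideanSpace ℝ (Fin d) → ℂ}
    {gv : EuclideanSpace ℝ (Fin d) → EuclideanSpace ℂ (Fin d)} (h : Represents k v gv)
    {x : L2Sum Ω} {y : Lp (EuclideanSpace ℂ (Fin d)) 2 (volOn Ω)}
    {f w : EuclideanSpace ℝ (Fin d) → ℂ}
    {g : EuclideanSpace ℝ (Fin d) → EuclideanSpace ℂ (Fin d)}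
    (hf : x.fst =ᵐ[volOn Ω] f) (hw : x.snd =ᵐ[surfOn Ω] w) (hg : y =ᵐ[volOn Ω] g) :
    inner ℂ k.fst x + inner ℂ k.snd y =
      (∫ x in Ω, f x * conj (v x)) + (∫ x in Ω, ∑ i : Fin d, g x i * starRingEnd ℂ (gv x i))
        + ∫ x, w x * conj (v x) ∂(surfOn Ω) := by
  rw [inner_L2Sum_eq, inner_Lp_eq_integral h.fst_fst hf, inner_Lp_eq_integral h.fst_snd hw,
    inner_Lp_eq_integral h.snd hg]
  simp only [RCLike.inner_apply, PiLp.inner_apply]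
  ring

lemma laplacian_eq_sum {φ : EuclideanSpace ℝ (Fin d) → ℂ} (hφ : IsTestFunction Ω φ)
    (x : EuclideanSpace ℝ (Fin d)) :
    Laplacian.laplacian φ x = ∑ i : Fin d,
      fderiv ℝ (fun y => fderiv ℝ φ y (EuclideanSpace.single i 1)) x
        (EuclideanSpace.single i 1) := by
  rw [InnerProductSpace.laplacian_eq_iteratedFDeriv_orthonormalBasis φ
    (EuclideanSpace.basisFun (Fin d) ℝ)]
  refine Finset.sum_congr rfl fun i _ => ?_
  rw [iteratedFDeriv_two_apply]
  have hd : DifferentiableAt ℝ (fderiv ℝ φ) x :=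
    (hφ.contDiff.fderiv_right (m := ((⊤ : ℕ∞) : WithTop ℕ∞)) (by simp)).differentiable (by simp) x
  rw [fderiv_clm_apply hd (differentiableAt_const _)]
  simp

end FormDomain

/-! ### Multiplication by β on the boundary -/

section BoundaryOperator

variable {d : ℕ} {Ω : Set (EuclideanSpace ℝ (Fin d))} {β : EuclideanSpace ℝ (Fin d) → ℂ}

/-- Multiplication by `β` on the boundary component, `(u, ψ) ↦ (0, β ψ)`. -/
def boundaryMul (hβ : MemLp β ∞ (surfOn Ω)) : L2Sum Ω →L[ℂ] L2Sum Ω :=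
  ((WithLp.prodContinuousLinearEquiv 2 ℂ (Lp ℂ 2 (volOn Ω)) (Lp ℂ 2 (surfOn Ω))).symm :
      _ →L[ℂ] L2Sum Ω).comp
    (((0 : Lp ℂ 2 (volOn Ω) →L[ℂ] Lp ℂ 2 (volOn Ω)).prodMap
      ((ContinuousLinearMap.mul ℂ ℂ).holderL (surfOn Ω) ∞ 2 2 (hβ.toLp β))).comp
    ((WithLp.prodContinuousLinearEquiv 2 ℂ (Lp ℂ 2 (volOn Ω)) (Lp ℂ 2 (surfOn Ω))) :
      L2Sum Ω →L[ℂ] _))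

lemma boundaryMul_fst (hβ : MemLp β ∞ (surfOn Ω)) (p : L2Sum Ω) :
    (boundaryMul hβ p).fst = 0 := rfl

lemma boundaryMul_snd (hβ : MemLp β ∞ (surfOn Ω)) (p : L2Sum Ω) :
    (boundaryMul hβ p).snd =ᵐ[surfOn Ω] fun x => β x * p.snd x := by
  have h1 : (boundaryMul hβ p).snd =ᵐ[surfOn Ω] fun x => (hβ.toLp β) x * p.snd x :=
    ContinuousLinearMap.coeFn_holder (r := 2) (ContinuousLinearMap.mul ℂ ℂ) (hβ.toLp β) p.snd
  filter_upwards [h1, hβ.coeFn_toLp] with x h1 h2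
  rw [h1, h2]

end BoundaryOperator

/-! ### The Wentzell Laplacian as a form operator -/

section Characterisation

variable {d : ℕ} {Ω : Set (EuclideanSpace ℝ (Fin d))} {β : EuclideanSpace ℝ (Fin d) → ℂ}

/-- For fixed k the tested identity is a closed condition on k', so testing on the dense continuous
part suffices. -/
lemma formRel_iff_contH1 {D : L2Sum Ω →L[ℂ] L2Sum Ω} {p q : L2Sum Ω} :
    formRel (formDomain Ω) D p q ↔ ∃ k ∈ formDomain Ω, k.fst = p ∧ ∀ k' v gv, Represents k' v gv →
      inner ℂ k'.fst (q + D p) + inner ℂ k'.snd k.snd = 0 := by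
  refine exists_congr fun k => and_congr_right fun _ => and_congr_right fun _ =>
    ⟨fun h k' v gv hk' => h k' hk'.mem_formDomain, fun h k' hk' => ?_⟩
  have hcl : IsClosed {k' : GradSpace Ω |
      inner ℂ k'.fst (q + D p) + inner ℂ k'.snd k.snd = 0} :=
    isClosed_eq (by fun_prop) continuous_const
  refine hcl.closure_subset_iff.2 ?_ hk'
  rintro k' ⟨v, gv, hk'⟩
  exact h k' v gv hk'

/-- The Wentzell Laplacian is the operator associated with the form. -/
theorem wentzellLaplacian_iff_formRel [IsFiniteMeasure (surfOn Ω)] (hΩ : IsOpen Ω)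
    (hΩb : Bornology.IsBounded Ω) (hβ : MemLp β ∞ (surfOn Ω)) (p q : L2Sum Ω) :
    wentzellLaplacian Ω β p q ↔ formRel (formDomain Ω) (boundaryMul hβ) p q := by
  have hq1 : (q + boundaryMul hβ p).fst = q.fst := by
    rw [WithLp.add_fst, boundaryMul_fst, add_zero]
  have hq2 : (q + boundaryMul hβ p).snd =ᵐ[surfOn Ω] fun x => q.snd x + β x * p.snd x := by
    rw [WithLp.add_snd]
    filter_upwards [Lp.coeFn_add q.snd (boundaryMul hβ p).snd, boundaryMul_snd hβ p] with x h1 h2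
    rw [h1, Pi.add_apply, h2]
  rw [formRel_iff_contH1]
  constructor
  · rintro ⟨-, hlap, htr, h, ⟨hh, g, f, hg, hf, hgreen⟩, hq⟩
    obtain ⟨k, hk, rfl⟩ := exists_mem_formDomain_of_isTrace hΩb htr
    refine ⟨k, hk, rfl, fun k' v gv hk' => ?_⟩
    have e1 : (q + boundaryMul hβ k.fst).fst =ᵐ[volOn Ω] f := by
      rw [hq1]; exact hlap.ae_eq hΩ hf
    have e2 : (q + boundaryMul hβ k.fst).snd =ᵐ[surfOn Ω] fun x => -h x := by
      filter_upwards [hq2, hq] with x h1 h2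
      rw [h1, h2]; ring
    -- The gradient in Green's formula was chosen independently of the one in k; uniqueness of weak
    -- gradients identifies them.
    have e3 : k.snd =ᵐ[volOn Ω] g :=
      (hasH1Gradient_of_mem_formDomain hk).ae_eq hΩ hg EventuallyEq.rfl
    rw [hk'.inner_eq e1 e2 e3, hgreen v gv hk'.continuousOn hk'.hasH1Gradient, ← integral_add]
    · simp
    · exact integrable_mul_of_memLp hh (memLp_surfOn hΩb hk'.continuousOn).star
    · exact integrable_mul_of_memLp hh.neg (memLp_surfOn hΩb hk'.continuousOn).star
  · rintro ⟨k, hk, rfl, h⟩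
    have hgrad := hasH1Gradient_of_mem_formDomain hk
    have hgreen : ∀ v gv, ContinuousOn v (closure Ω) → HasH1Gradient Ω v gv →
        (∫ x in Ω, q.fst x * conj (v x)) +
          (∫ x in Ω, ∑ i : Fin d, k.snd x i * starRingEnd ℂ (gv x i)) +
          ∫ x, (q.snd x + β x * k.fst.snd x) * conj (v x) ∂(surfOn Ω) = 0 := by
      intro v gv hv hgv
      obtain ⟨k', hk'⟩ := exists_represents hΩb hv hgv
      rw [← hk'.inner_eq (Eventually.of_forall fun x => by rw [hq1]) hq2 EventuallyEq.rfl]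
      exact h k' v gv hk'
    -- Conjugated test functions vanish on Γ, so the boundary term drops out; applying the weak
    -- gradient identity to each ∂_i φ recovers the distributional Laplacian.
    have hlap : HasL2Laplacian Ω k.fst.fst q.fst := by
      refine ⟨Lp.memLp _, fun φ hφ => ?_⟩
      have hφ1 : ContDiff ℝ 1 fun x => conj (φ x) := hφ.conj.contDiff.of_le (by simp)
      have h1 := hgreen _ _ hφ1.continuous.continuousOn (hasH1Gradient_of_contDiff hΩ hΩb hφ1)
      have h2 : ∫ x, (q.snd x + β x * k.fst.snd x) * conj (conj (φ x)) ∂(surfOn Ω) = 0 := by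
        refine integral_eq_zero_of_ae ?_
        filter_upwards [ae_restrict_mem isClosed_frontier.measurableSet] with x hx
        have : φ x = 0 := image_eq_zero_of_notMem_tsupport fun hx' =>
          (hΩ.frontier_eq ▸ hx).2 (hφ.tsupport_subset hx')
        simp [this]
      have h3 : ∀ (x : EuclideanSpace ℝ (Fin d)) (i : Fin d),
          conj (fderiv ℝ (fun x => conj (φ x)) x (EuclideanSpace.single i 1)) =
          fderiv ℝ φ x (EuclideanSpace.single i 1) := by
        intro x i
        have hd := (hφ.contDiff.differentiable (by simp) x).hasFDerivAt
        have := (Complex.conjCLE.toContinuousLinearMap.hasFDerivAt.comp x hd).fderiv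
        rw [show fderiv ℝ (fun x => conj (φ x)) x = _ from this]
        simp
      rw [h2, add_zero] at h1
      simp only [h3, RCLike.conj_conj] at h1
      have hi : ∀ i, Integrable (fun x => k.snd x i * fderiv ℝ φ x (EuclideanSpace.single i 1))
          (volOn Ω) := fun i =>
        integrable_mul_of_memLp (MemLp.euclidean_apply hgrad.memLp_grad i) (hφ.fderiv_apply _).memLp
      have hi' : ∀ i, Integrable (fun x => k.fst.fst x * fderiv ℝ (fun y => fderiv ℝ φ y
          (EuclideanSpace.single i 1)) x (EuclideanSpace.single i 1)) (volOn Ω) := fun i =>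
        integrable_mul_of_memLp hgrad.memLp ((hφ.fderiv_apply _).fderiv_apply _).memLp
      rw [integral_finsetSum _ fun i _ => hi i] at h1
      simp only [laplacian_eq_sum hφ, Finset.mul_sum]
      rw [integral_finsetSum _ fun i _ => hi' i]
      simp only [hgrad.weak _ (hφ.fderiv_apply _)]
      rw [Finset.sum_neg_distrib]
      exact (eq_neg_of_add_eq_zero_left h1).symm
    refine ⟨⟨_, hgrad⟩, hlap, isTrace_of_mem_formDomain hk,
      fun x => -(q.snd x + β x * k.fst.snd x), ⟨?_, k.snd, q.fst, hgrad, hlap, ?_⟩,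
      Eventually.of_forall fun x => by ring⟩
    · exact ((Lp.memLp (q + boundaryMul hβ k.fst).snd).ae_eq hq2).neg
    · intro v gv hv hgv
      have := hgreen v gv hv hgv
      rw [eq_neg_of_add_eq_zero_left this, ← integral_neg]
      simp only [neg_mul]

/-- The operator associated with the form is single-valued, since `C(closure Ω) ∩ H¹(Ω)` is
dense in `L²(Ω) ⊕ L²(Γ)`. -/
theorem formRel_zero_eq_zero [IsFiniteMeasure (surfOn Ω)] (hΩ : IsOpen Ω)
    (hΩb : Bornology.IsBounded Ω) (D : L2Sum Ω →L[ℂ] L2Sum Ω) (q : L2Sum Ω)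
    (h : formRel (formDomain Ω) D 0 q) : q = 0 := by
  obtain ⟨k, hk, hk0, h⟩ := h
  -- With u = 0 the gradient vanishes too, so the form equation only says that q is orthogonal to
  -- all pairs (v, v|_Γ).
  have hz : k.snd = 0 := by
    have h1 := hasH1Gradient_of_mem_formDomain hk
    have h2 := hasH1Gradient_of_mem_formDomain (formDomain Ω).zero_mem
    have h3 := h1.ae_eq hΩ h2 (by rw [hk0]; rfl)
    exact Lp.ext h3
  rw [map_zero, add_zero, hz] at h
  simp only [inner_zero_right, add_zero] at h
  have hint : ∀ v gv, ContinuousOn v (closure Ω) → HasH1Gradient Ω v gv →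
      (∫ x in Ω, q.fst x * conj (v x)) + ∫ x, q.snd x * conj (v x) ∂(surfOn Ω) = 0 := by
    intro v gv hv hgv
    obtain ⟨k', hk'⟩ := exists_represents hΩb hv hgv
    have h1 := h k' hk'.mem_formDomain
    rw [inner_L2Sum_eq, inner_Lp_eq_integral hk'.fst_fst EventuallyEq.rfl,
      inner_Lp_eq_integral hk'.fst_snd EventuallyEq.rfl] at h1
    simpa only [RCLike.inner_apply] using h1
  have hq1 : q.fst =ᵐ[volOn Ω] 0 := by
    refine ae_eq_zero_of_integral_test hΩ (Lp.memLp _) fun φ hφ => ?_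
    have hφ1 : ContDiff ℝ 1 fun x => conj (φ x) := hφ.conj.contDiff.of_le (by simp)
    have h1 := hint _ _ hφ1.continuous.continuousOn (hasH1Gradient_of_contDiff hΩ hΩb hφ1)
    have h2 : ∫ x, q.snd x * conj (conj (φ x)) ∂(surfOn Ω) = 0 := by
      refine integral_eq_zero_of_ae ?_
      filter_upwards [ae_restrict_mem isClosed_frontier.measurableSet] with x hx
      have : φ x = 0 := image_eq_zero_of_notMem_tsupport fun hx' =>
        (hΩ.frontier_eq ▸ hx).2 (hφ.tsupport_subset hx')
      simp [this]
    rw [h2, add_zero] at h1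
    simpa only [RCLike.conj_conj] using h1
  -- Since the interior component is already zero, arbitrary functions in C_c^∞(ℝᵈ) may be used, and
  -- these detect elements of L²(Γ).
  have hq2 : q.snd =ᵐ[surfOn Ω] 0 := by
    refine ae_eq_zero_of_integral_contDiff_smul_eq_zero
      ((Lp.memLp q.snd).locallyIntegrable one_le_two) fun φ hφ _ => ?_
    have hφ1 : ContDiff ℝ 1 fun x => (φ x : ℂ) :=
      Complex.ofRealCLM.contDiff.comp (hφ.of_le (by simp))
    have h1 := hint _ _ hφ1.continuous.continuousOn (hasH1Gradient_of_contDiff hΩ hΩb hφ1)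
    have h2 : ∫ x in Ω, q.fst x * conj (φ x : ℂ) = 0 := by
      refine integral_eq_zero_of_ae ?_
      filter_upwards [hq1] with x hx
      simp [hx]
    rw [h2, zero_add] at h1
    rw [← h1]
    refine integral_congr_ae (Eventually.of_forall fun x => ?_)
    simp [mul_comm]
  have e1 : q.fst = 0 := Lp.ext (hq1.trans (Lp.coeFn_zero _ _ _).symm)
  have e2 : q.snd = 0 := Lp.ext (hq2.trans (Lp.coeFn_zero _ _ _).symm)
  exact WithLp.ofLp_injective 2 (Prod.ext e1 e2)

end Characterisation

/-! ### A smooth truncation of complex numbers -/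

section Excess

/-- A smooth substitute for `z ↦ (|z| - M)⁺ z / |z|`: it vanishes exactly on the disc of radius
`M` and is a nonnegative multiple of `z`. -/
def excess (M : ℝ) (z : ℂ) : ℂ := Real.smoothTransition (‖z‖ ^ 2 - M ^ 2) • z

lemma excess_zero (M : ℝ) : excess M 0 = 0 := by simp [excess]

lemma re_inner_real_smul_left {F : Type*} [NormedAddCommGroup F] [InnerProductSpace ℂ F] (r : ℝ)
    (x y : F) : RCLike.re (inner ℂ (r • x) y) = r * RCLike.re (inner ℂ x y) := by
  rw [← Complex.coe_smul, inner_smul_left, Complex.conj_ofReal]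
  exact RCLike.re_ofReal_mul r _

lemma contDiff_excess (M : ℝ) : ContDiff ℝ 1 (excess M) :=
  (Real.smoothTransition.contDiff.comp ((contDiff_norm_sq ℝ).sub contDiff_const)).smul contDiff_id

lemma fderiv_excess_apply (M : ℝ) (z ζ : ℂ) :
    fderiv ℝ (excess M) z ζ = Real.smoothTransition (‖z‖ ^ 2 - M ^ 2) • ζ +
      (deriv Real.smoothTransition (‖z‖ ^ 2 - M ^ 2) * (2 * inner ℝ z ζ)) • z := by
  have h1 : HasFDerivAt (fun z : ℂ => ‖z‖ ^ 2 - M ^ 2)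
      (2 • (innerSL ℝ z).comp (ContinuousLinearMap.id ℝ ℂ)) z :=
    ((hasFDerivAt_id z).norm_sq).sub_const _
  have h2 : HasDerivAt Real.smoothTransition
      (deriv Real.smoothTransition (‖z‖ ^ 2 - M ^ 2)) (‖z‖ ^ 2 - M ^ 2) :=
    ((Real.smoothTransition.contDiff (n := 1)).differentiable one_ne_zero _).hasDerivAt
  have h3 := (h2.comp_hasFDerivAt z h1).smul (hasFDerivAt_id z)
  rw [show fderiv ℝ (excess M) z = _ from h3.fderiv]
  change Real.smoothTransition (‖z‖ ^ 2 - M ^ 2) • ζ +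
    (deriv Real.smoothTransition (‖z‖ ^ 2 - M ^ 2) * (2 • inner ℝ z ζ)) • z = _
  rw [nsmul_eq_mul, Nat.cast_ofNat]

/-- Beyond radius |M| + 1 one has |z|² - M² ≥ 1 and the map is the identity; the remaining disc is
compact. -/
lemma exists_bound_fderiv_excess (M : ℝ) : ∃ C : ℝ≥0, ∀ z, ‖fderiv ℝ (excess M) z‖ ≤ C := by
  obtain ⟨C, hC⟩ := (isCompact_closedBall (0 : ℂ) (|M| + 1)).exists_bound_of_continuousOn
    ((contDiff_excess M).continuous_fderiv one_ne_zero).continuousOn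
  refine ⟨Real.toNNReal (max C 1), fun z => ?_⟩
  rw [Real.coe_toNNReal _ (le_max_of_le_right zero_le_one)]
  by_cases hz : z ∈ Metric.closedBall (0 : ℂ) (|M| + 1)
  · exact (hC z hz).trans (le_max_left _ _)
  · have h1 : excess M =ᶠ[𝓝 z] id := by
      filter_upwards [Metric.isClosed_closedBall.isOpen_compl.mem_nhds hz] with w hw
      have hw' : |M| + 1 < ‖w‖ := by simpa using hw
      have h2 : 1 ≤ ‖w‖ ^ 2 - M ^ 2 := by
        have := sq_abs M
        nlinarith [abs_nonneg M]
      simp [excess, Real.smoothTransition.one_of_one_le h2]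
    rw [h1.fderiv_eq, fderiv_id]
    exact ContinuousLinearMap.norm_id_le.trans (le_max_right _ _)

/-- With θ the smooth transition, the derivative is θ·Id plus 2θ' times the real rank-one map ζ ↦
⟨z, ζ⟩z. Both parts are positive semidefinite because θ is nonnegative and nondecreasing. This is
the pointwise accretivity of the gradient form. -/
lemma re_inner_fderiv_excess_nonneg (M : ℝ) (z ζ : ℂ) :
    0 ≤ RCLike.re (inner ℂ (fderiv ℝ (excess M) z ζ) ζ) := by
  have h1 : RCLike.re (inner ℂ z ζ) = inner ℝ z ζ := by
    rw [Complex.inner]; simp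
  rw [fderiv_excess_apply, inner_add_left, map_add, re_inner_real_smul_left,
    re_inner_real_smul_left, inner_self_eq_norm_sq, h1]
  have h2 := Real.smoothTransition.nonneg (‖z‖ ^ 2 - M ^ 2)
  have h3 : 0 ≤ deriv Real.smoothTransition (‖z‖ ^ 2 - M ^ 2) :=
    Real.smoothTransition.monotone.deriv_nonneg
  have h4 := mul_nonneg h3 (sq_nonneg (inner ℝ z ζ))
  have h5 := mul_nonneg h2 (sq_nonneg ‖ζ‖)
  nlinarith

lemma excess_eq_zero_iff {M : ℝ} (hM : 0 ≤ M) (z : ℂ) : excess M z = 0 ↔ ‖z‖ ≤ M := by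
  rw [excess, smul_eq_zero, Real.smoothTransition.zero_iff_nonpos, sub_nonpos,
    sq_le_sq₀ (norm_nonneg z) hM]
  refine or_iff_left_of_imp ?_
  rintro rfl
  simpa using hM

/-- If |w| ≤ M < |z|, then Re⟨z, z - w⟩ ≥ |z|(|z| - |w|) > 0, and the truncation is a positive
multiple of z. -/
lemma re_inner_excess_nonneg {M : ℝ} (z : ℂ) {w : ℂ} (hM : 0 ≤ M) (hw : ‖w‖ ≤ M) :
    0 ≤ RCLike.re (inner ℂ (excess M z) (z - w)) ∧
      (RCLike.re (inner ℂ (excess M z) (z - w)) = 0 → ‖z‖ ≤ M) := by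
  rcases le_or_gt ‖z‖ M with h | h
  · rw [(excess_eq_zero_iff hM z).2 h]
    simp [h]
  · have h1 : 0 < Real.smoothTransition (‖z‖ ^ 2 - M ^ 2) :=
      Real.smoothTransition.pos_of_pos (by nlinarith)
    have h2 : 0 < RCLike.re (inner ℂ z (z - w)) := by
      rw [inner_sub_right, map_sub, inner_self_eq_norm_sq]
      have := re_inner_le_norm (𝕜 := ℂ) z w
      nlinarith [norm_nonneg w]
    have h3 : 0 < RCLike.re (inner ℂ (excess M z) (z - w)) := by
      rw [excess, re_inner_real_smul_left]
      exact mul_pos h1 h2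
    exact ⟨h3.le, fun h0 => absurd h0 h3.ne'⟩

lemma exists_lipschitzWith_excess (M : ℝ) : ∃ C : ℝ≥0, LipschitzWith C (excess M) := by
  obtain ⟨C, hC⟩ := exists_bound_fderiv_excess M
  exact ⟨C, lipschitzWith_of_nnnorm_fderiv_le
    ((contDiff_excess M).differentiable one_ne_zero) fun z => hC z⟩

variable {α : Type*} [MeasurableSpace α] {μ : Measure α}

/-- The superposition operator of `excess M` on `L²`. -/
def excessLp (M : ℝ) : Lp ℂ 2 μ → Lp ℂ 2 μ :=
  (Classical.choose_spec (exists_lipschitzWith_excess M)).compLp (excess_zero M)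

lemma coeFn_excessLp (M : ℝ) (f : Lp ℂ 2 μ) :
    excessLp M f =ᵐ[μ] fun x => excess M (f x) :=
  LipschitzWith.coeFn_compLp _ (excess_zero M) f

lemma continuous_excessLp (M : ℝ) : Continuous (excessLp M : Lp ℂ 2 μ → Lp ℂ 2 μ) :=
  LipschitzWith.continuous_compLp _ (excess_zero M)

lemma excessLp_eq_zero_iff {M : ℝ} (hM : 0 ≤ M) (f : Lp ℂ 2 μ) :
    excessLp M f = 0 ↔ ∀ᵐ x ∂μ, ‖f x‖ ≤ M := by
  rw [Lp.eq_zero_iff_ae_eq_zero]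
  constructor
  · intro h
    filter_upwards [h, coeFn_excessLp M f] with x h1 h2
    rw [← excess_eq_zero_iff hM, ← h2, h1, Pi.zero_apply]
  · intro h
    filter_upwards [h, coeFn_excessLp M f] with x h1 h2
    rw [h2, (excess_eq_zero_iff hM _).2 h1, Pi.zero_apply]

lemma re_inner_Lp_eq_integral {F : Type*} [NormedAddCommGroup F] [InnerProductSpace ℂ F]
    (f g : Lp F 2 μ) :
    RCLike.re (inner ℂ f g) = ∫ x, RCLike.re (inner ℂ (f x) (g x)) ∂μ := by
  rw [L2.inner_def, integral_re (L2.integrable_inner f g)]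

lemma re_inner_excessLp_nonneg {M : ℝ} (hM : 0 ≤ M) (p f : Lp ℂ 2 μ)
    (hf : ∀ᵐ x ∂μ, ‖f x‖ ≤ M) :
    0 ≤ RCLike.re (inner ℂ (excessLp M p) (p - f)) ∧
      (RCLike.re (inner ℂ (excessLp M p) (p - f)) = 0 → ∀ᵐ x ∂μ, ‖p x‖ ≤ M) := by
  have h : ∀ᵐ x ∂μ, 0 ≤ RCLike.re (inner ℂ (excessLp M p x) ((p - f : Lp ℂ 2 μ) x)) ∧
      (RCLike.re (inner ℂ (excessLp M p x) ((p - f : Lp ℂ 2 μ) x)) = 0 → ‖p x‖ ≤ M) := by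
    filter_upwards [coeFn_excessLp M p, Lp.coeFn_sub p f, hf] with x h1 h2 h3
    rw [h1, h2, Pi.sub_apply]
    exact re_inner_excess_nonneg _ hM h3
  rw [re_inner_Lp_eq_integral]
  refine ⟨integral_nonneg_of_ae (h.mono fun x hx => hx.1), fun h0 => ?_⟩
  rw [integral_eq_zero_iff_of_nonneg_ae (h.mono fun x hx => hx.1)
    (L2.integrable_inner _ _).re] at h0
  filter_upwards [h, h0] with x h1 h2
  exact h1.2 h2

end Excess

/-! ### Accretivity of the form against truncations -/

section Truncation

variable {d : ℕ} {Ω : Set (EuclideanSpace ℝ (Fin d))}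

/-- The superposition operator of `excess M` on `L²(Ω) ⊕ L²(Γ)`. -/
def excessSum (M : ℝ) (p : L2Sum Ω) : L2Sum Ω :=
  WithLp.toLp 2 (excessLp M p.fst, excessLp M p.snd)

lemma continuous_excessSum (M : ℝ) : Continuous (excessSum M : L2Sum Ω → L2Sum Ω) := by
  have h1 : Continuous fun p : L2Sum Ω => p.fst := by fun_prop
  have h2 : Continuous fun p : L2Sum Ω => p.snd := by fun_prop
  exact (WithLp.prod_continuous_toLp 2 _ _).comp
    (((continuous_excessLp M).comp h1).prodMk ((continuous_excessLp M).comp h2))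

lemma norm_toLp_fderiv_excess_le {M : ℝ} {C : ℝ≥0} (hC : ∀ z, ‖fderiv ℝ (excess M) z‖ ≤ C) (z : ℂ)
    (g : EuclideanSpace ℂ (Fin d)) :
    ‖(WithLp.toLp 2 fun i => fderiv ℝ (excess M) z (g i) : EuclideanSpace ℂ (Fin d))‖ ≤
      C * ‖g‖ := by
  rw [EuclideanSpace.norm_eq, EuclideanSpace.norm_eq]
  refine Real.sqrt_le_iff.2 ⟨by positivity, ?_⟩
  rw [mul_pow, Real.sq_sqrt (by positivity), Finset.mul_sum]
  refine Finset.sum_le_sum fun i _ => ?_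
  rw [← mul_pow]
  gcongr
  exact (fderiv ℝ (excess M) z).le_of_opNorm_le (hC z) _

/-- Truncation acts on the continuous part of the form domain; the form is accretive against it. -/
lemma Represents.exists_excess [IsFiniteMeasure (surfOn Ω)] (hΩ : IsOpen Ω)
    (hΩb : Bornology.IsBounded Ω) {M : ℝ} {C : ℝ≥0} (hC : ∀ z, ‖fderiv ℝ (excess M) z‖ ≤ C)
    {k : GradSpace Ω} {v : EuclideanSpace ℝ (Fin d) → ℂ}
    {gv : EuclideanSpace ℝ (Fin d) → EuclideanSpace ℂ (Fin d)} (h : Represents k v gv) :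
    ∃ k' ∈ formDomain Ω, k'.fst = excessSum M k.fst ∧ ‖k'.snd‖ ≤ C * ‖k.snd‖ ∧
      0 ≤ RCLike.re (inner ℂ k'.snd k.snd) := by
  have hgrad := h.hasH1Gradient.comp hΩ hΩb h.continuousOn (contDiff_excess M) hC
  obtain ⟨k', hk'⟩ := exists_represents hΩb
    ((contDiff_excess M).continuous.comp_continuousOn h.continuousOn) hgrad
  refine ⟨k', hk'.mem_formDomain, ?_, ?_, ?_⟩
  · refine WithLp.ofLp_injective 2 (Prod.ext (Lp.ext ?_) (Lp.ext ?_))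
    · change k'.fst.fst =ᵐ[volOn Ω] excessLp M k.fst.fst
      filter_upwards [hk'.fst_fst, coeFn_excessLp M k.fst.fst, h.fst_fst] with x h1 h2 h3
      rw [h1, h2, h3]
      rfl
    · change k'.fst.snd =ᵐ[surfOn Ω] excessLp M k.fst.snd
      filter_upwards [hk'.fst_snd, coeFn_excessLp M k.fst.snd, h.fst_snd] with x h1 h2 h3
      rw [h1, h2, h3]
      rfl
  · refine Lp.norm_le_mul_norm_of_ae_le_mul ?_
    filter_upwards [hk'.snd, h.snd] with x h1 h2
    rw [h1, h2]
    exact norm_toLp_fderiv_excess_le hC _ _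
  · rw [re_inner_Lp_eq_integral]
    refine integral_nonneg_of_ae ?_
    filter_upwards [hk'.snd, h.snd] with x h1 h2
    rw [h1, h2, PiLp.inner_apply, map_sum]
    exact Finset.sum_nonneg fun i _ => re_inner_fderiv_excess_nonneg M _ _

/-- The operator associated with the form, up to the zeroth order part, is dissipative against
truncations. -/
lemma re_inner_excessSum_nonpos [IsFiniteMeasure (surfOn Ω)] (hΩ : IsOpen Ω)
    (hΩb : Bornology.IsBounded Ω) (M : ℝ) {D : L2Sum Ω →L[ℂ] L2Sum Ω} {p q : L2Sum Ω}
    (h : formRel (formDomain Ω) D p q) :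
    RCLike.re (inner ℂ (excessSum M p) (q + D p)) ≤ 0 := by
  obtain ⟨C, hC⟩ := exists_bound_fderiv_excess M
  obtain ⟨k, hk, rfl, h⟩ := h
  obtain ⟨kn, hkn, hlim⟩ := mem_closure_iff_seq_limit.1 hk
  choose vn gn hrep using hkn
  -- The truncated gradients need not be shown to converge: they are accretive against ∇v_n and
  -- bounded by C‖∇v_n‖, so replacing ∇v_n by its limit costs at most C‖∇v_n‖ times the distance
  -- between the two.
  choose k' hk'V hk'1 hk'2 hk'3 using fun n => (hrep n).exists_excess hΩ hΩb hC (M := M)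
  have c1 : Continuous fun k : GradSpace Ω => k.fst := by fun_prop
  have c2 : Continuous fun k : GradSpace Ω => k.snd := by fun_prop
  have t1 : Tendsto (fun n => RCLike.re (inner ℂ (excessSum M (kn n).fst) (q + D k.fst))) atTop
      (𝓝 (RCLike.re (inner ℂ (excessSum M k.fst) (q + D k.fst)))) :=
    ((RCLike.continuous_re.comp (((continuous_excessSum M).comp c1).inner
      continuous_const)).tendsto k).comp hlim
  have t2 : Tendsto (fun n => C * ‖(kn n).snd‖ * ‖(kn n).snd - k.snd‖) atTop (𝓝 0) := by
    have h1 : Tendsto (fun n => (kn n).snd) atTop (𝓝 k.snd) := (c2.tendsto k).comp hlim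
    simpa using (h1.norm.const_mul (C : ℝ)).mul (h1.sub_const k.snd).norm
  refine le_of_tendsto_of_tendsto' t1 t2 fun n => ?_
  have h1 := congrArg RCLike.re (h (k' n) (hk'V n))
  rw [hk'1, map_add, map_zero] at h1
  have h2 : RCLike.re (inner ℂ (k' n).snd ((kn n).snd - k.snd)) ≤
      C * ‖(kn n).snd‖ * ‖(kn n).snd - k.snd‖ :=
    (re_inner_le_norm _ _).trans (mul_le_mul_of_nonneg_right (hk'2 n) (norm_nonneg _))
  rw [inner_sub_right, map_sub] at h2
  have h3 := hk'3 n
  linarith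

end Truncation

/-! ### Generation and invariance of L^∞ balls -/

section Generation

variable {d : ℕ} {Ω : Set (EuclideanSpace ℝ (Fin d))} {β : EuclideanSpace ℝ (Fin d) → ℂ}

/-- The zeroth order part `(u, ψ) ↦ (ω u, (ω + β) ψ)` of the shifted Wentzell Laplacian. -/
def zerothOrder (hβ : MemLp β ∞ (surfOn Ω)) (ω : ℝ) : L2Sum Ω →L[ℂ] L2Sum Ω :=
  (ω : ℂ) • ContinuousLinearMap.id ℂ (L2Sum Ω) + boundaryMul hβ

lemma subScalar_wentzellLaplacian_eq [IsFiniteMeasure (surfOn Ω)] (hΩ : IsOpen Ω)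
    (hΩb : Bornology.IsBounded Ω) (hβ : MemLp β ∞ (surfOn Ω)) (ω : ℝ) :
    subScalar (wentzellLaplacian Ω β) ω = formRel (formDomain Ω) (zerothOrder hβ ω) := by
  ext p q
  have e : q + (ω : ℂ) • p + boundaryMul hβ p = q + zerothOrder hβ ω p := by
    rw [add_assoc]; rfl
  rw [subScalar, wentzellLaplacian_iff_formRel hΩ hΩb hβ, formRel, formRel, e]

/-- The zeroth order part is accretive against nonnegative multiples. -/
lemma re_inner_zerothOrder_nonneg (hβ : MemLp β ∞ (surfOn Ω)) {ω : ℝ} (hω : 0 ≤ ω)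
    (hβω : ∀ᵐ x ∂(surfOn Ω), ‖β x‖ ≤ ω) {p r : L2Sum Ω} {c : ℂ → ℝ} (hc : ∀ z, 0 ≤ c z)
    (h1 : r.fst =ᵐ[volOn Ω] fun x => c (p.fst x) • p.fst x)
    (h2 : r.snd =ᵐ[surfOn Ω] fun x => c (p.snd x) • p.snd x) :
    0 ≤ RCLike.re (inner ℂ r (zerothOrder hβ ω p)) := by
  rw [inner_L2Sum_eq, map_add, re_inner_Lp_eq_integral, re_inner_Lp_eq_integral]
  have e1 : (zerothOrder hβ ω p).fst = (ω : ℂ) • p.fst := by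
    change (ω : ℂ) • p.fst + (boundaryMul hβ p).fst = _
    rw [boundaryMul_fst, add_zero]
  have e2 : (zerothOrder hβ ω p).snd = (ω : ℂ) • p.snd + (boundaryMul hβ p).snd := rfl
  refine add_nonneg (integral_nonneg_of_ae ?_) (integral_nonneg_of_ae ?_)
  · rw [e1]
    filter_upwards [h1, Lp.coeFn_smul (ω : ℂ) p.fst] with x h1 h2
    rw [h1, h2, Pi.smul_apply, re_inner_real_smul_left, inner_smul_right, Pi.zero_apply]
    refine mul_nonneg (hc _) ?_
    have h3 : RCLike.re ((ω : ℂ) * inner ℂ (p.fst x) (p.fst x)) =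
        ω * RCLike.re (inner ℂ (p.fst x) (p.fst x)) := RCLike.re_ofReal_mul ω _
    rw [h3]
    exact mul_nonneg hω inner_self_nonneg
  · rw [e2]
    filter_upwards [h2, hβω, Lp.coeFn_smul (ω : ℂ) p.snd, boundaryMul_snd hβ p,
      Lp.coeFn_add ((ω : ℂ) • p.snd) (boundaryMul hβ p).snd] with x h2 h3 h4 h5 h6
    rw [h2, h6, Pi.add_apply, h4, h5, Pi.smul_apply, re_inner_real_smul_left, Pi.zero_apply]
    refine mul_nonneg (hc _) ?_
    have h7 : (ω : ℂ) • p.snd x + β x * p.snd x = ((ω : ℂ) + β x) • p.snd x := by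
      rw [smul_eq_mul, smul_eq_mul, add_mul]
    rw [h7, inner_smul_right, inner_self_eq_norm_sq_to_K]
    have h8 : RCLike.re (((ω : ℂ) + β x) * ((‖p.snd x‖ : ℝ) : ℂ) ^ 2) =
        (ω + (β x).re) * ‖p.snd x‖ ^ 2 := by
      rw [← Complex.ofReal_pow, mul_comm, mul_comm (ω + _)]
      change Complex.re _ = _
      rw [Complex.re_ofReal_mul, Complex.add_re, Complex.ofReal_re]
    refine le_of_le_of_eq ?_ h8.symm
    -- This is where the shift enters: Re(ω + β) ≥ ω - |β| ≥ 0.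
    have h9 := neg_le_of_abs_le (Complex.abs_re_le_norm (β x))
    exact mul_nonneg (by linarith) (sq_nonneg _)

theorem isMDissipative_zerothOrder [IsFiniteMeasure (surfOn Ω)] (hΩ : IsOpen Ω)
    (hΩb : Bornology.IsBounded Ω) (hβ : MemLp β ∞ (surfOn Ω)) {ω : ℝ} (hω : 0 ≤ ω)
    (hβω : ∀ᵐ x ∂(surfOn Ω), ‖β x‖ ≤ ω) :
    IsMDissipative (formRel (formDomain Ω) (zerothOrder hβ ω)) :=
  formRel_isMDissipative isClosed_formDomain
    (fun p => re_inner_zerothOrder_nonneg hβ hω hβω (c := fun _ => 1) (fun _ => zero_le_one)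
      (by simp) (by simp))
    (formRel_zero_eq_zero hΩ hΩb _)

/-- The closed ball of radius `M` in `L^∞(Ω) ⊕ L^∞(Γ)`. -/
def linftyBall (Ω : Set (EuclideanSpace ℝ (Fin d))) (M : ℝ) : Set (L2Sum Ω) :=
  {p | (∀ᵐ x ∂(volOn Ω), ‖p.fst x‖ ≤ M) ∧ ∀ᵐ x ∂(surfOn Ω), ‖p.snd x‖ ≤ M}

/-- The ball is the zero set of the truncation, which is continuous on L² because it is Lipschitz
and fixes 0. -/
lemma isClosed_linftyBall {M : ℝ} (hM : 0 ≤ M) : IsClosed (linftyBall Ω M) := by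
  have e : linftyBall Ω M = {p : L2Sum Ω | excessLp M p.fst = 0} ∩ {p | excessLp M p.snd = 0} := by
    ext p
    exact (and_congr (excessLp_eq_zero_iff hM _) (excessLp_eq_zero_iff hM _)).symm
  rw [e]
  have h1 : Continuous fun p : L2Sum Ω => p.fst := by fun_prop
  have h2 : Continuous fun p : L2Sum Ω => p.snd := by fun_prop
  exact (isClosed_eq ((continuous_excessLp M).comp h1) continuous_const).inter
    (isClosed_eq ((continuous_excessLp M).comp h2) continuous_const)

lemma ae_norm_le_iff_eLpNorm_top_le {α : Type*} [MeasurableSpace α] {μ : Measure α} {f : α → ℂ}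
    {M : ℝ} (hM : 0 ≤ M) : (∀ᵐ x ∂μ, ‖f x‖ ≤ M) ↔ eLpNorm f ∞ μ ≤ ENNReal.ofReal M := by
  rw [eLpNorm_exponent_top]
  refine ⟨eLpNormEssSup_le_of_ae_bound, fun h => ?_⟩
  filter_upwards [ae_le_eLpNormEssSup (f := f) (μ := μ)] with x hx
  have := hx.trans h
  rwa [← ofReal_norm, ENNReal.ofReal_le_ofReal_iff hM] at this

lemma mem_linftyBall_iff {M : ℝ} (hM : 0 ≤ M) {p : L2Sum Ω} :
    p ∈ linftyBall Ω M ↔ linftyNorm Ω p ≤ ENNReal.ofReal M := by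
  rw [linftyNorm, max_le_iff, ← ae_norm_le_iff_eLpNorm_top_le hM,
    ← ae_norm_le_iff_eLpNorm_top_le hM]
  rfl

/-- The resolvents of the shifted Wentzell Laplacian leave the balls of
`L^∞(Ω) ⊕ L^∞(Γ)` invariant. -/
lemma mem_linftyBall_of_formRel [IsFiniteMeasure (surfOn Ω)] (hΩ : IsOpen Ω)
    (hΩb : Bornology.IsBounded Ω) (hβ : MemLp β ∞ (surfOn Ω)) {ω : ℝ} (hω : 0 ≤ ω)
    (hβω : ∀ᵐ x ∂(surfOn Ω), ‖β x‖ ≤ ω) {M : ℝ} (hM : 0 ≤ M) {h : ℝ} (hh : 0 < h)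
    {p f : L2Sum Ω} (hf : f ∈ linftyBall Ω M)
    (hp : formRel (formDomain Ω) (zerothOrder hβ ω) p ((h : ℂ)⁻¹ • (p - f))) :
    p ∈ linftyBall Ω M := by
  have h1 := re_inner_excessSum_nonpos hΩ hΩb M hp
  have h2 : 0 ≤ RCLike.re (inner ℂ (excessSum M p) (zerothOrder hβ ω p)) :=
    re_inner_zerothOrder_nonneg hβ hω hβω
      (c := fun z => Real.smoothTransition (‖z‖ ^ 2 - M ^ 2))
      (fun z => Real.smoothTransition.nonneg _) (coeFn_excessLp M p.fst) (coeFn_excessLp M p.snd)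
  rw [inner_add_right, map_add, inner_smul_right, ← Complex.ofReal_inv] at h1
  have h3 : RCLike.re (((h⁻¹ : ℝ) : ℂ) * inner ℂ (excessSum M p) (p - f)) =
      h⁻¹ * RCLike.re (inner ℂ (excessSum M p) (p - f)) := RCLike.re_ofReal_mul _ _
  rw [h3] at h1
  -- Both the form and the zeroth order part are accretive against the truncation. The interior and
  -- boundary terms of this inner product are each nonnegative, so both vanish.
  have h4 : RCLike.re (inner ℂ (excessSum M p) (p - f)) ≤ 0 := by
    by_contra! hpos
    linarith [mul_pos (inv_pos.2 hh) hpos]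
  rw [inner_L2Sum_eq, map_add] at h4
  have h5 := re_inner_excessLp_nonneg hM p.fst f.fst hf.1
  have h6 := re_inner_excessLp_nonneg hM p.snd f.snd hf.2
  have h7 : RCLike.re (inner ℂ (excessLp M p.fst) (p.fst - f.fst)) +
      RCLike.re (inner ℂ (excessLp M p.snd) (p.snd - f.snd)) ≤ 0 := h4
  exact ⟨h5.2 (by linarith [h5.1, h6.1]), h6.2 (by linarith [h5.1, h6.1])⟩

end Generation

end Wentzell

end

theorem proposition3p5 (d : ℕ) (hd : 1 ≤ d) (Ω : Set (EuclideanSpace ℝ (Fin d)))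
    (hΩ : IsOpen Ω) (hΩb : Bornology.IsBounded Ω)
    (hΓ : (Measure.euclideanHausdorffMeasure (d - 1) : Measure (EuclideanSpace ℝ (Fin d)))
      (frontier Ω) < ∞)
    (β : EuclideanSpace ℝ (Fin d) → ℂ) (hβ : MemLp β ∞ (Wentzell.surfOn Ω)) :
    ∃ ω₀ : ℝ, 0 ≤ ω₀ ∧
      (∃ S : ℝ≥0 → Wentzell.L2Sum Ω →L[ℂ] Wentzell.L2Sum Ω,
        Wentzell.Generates
          (Wentzell.subScalar (Wentzell.wentzellLaplacian Ω β) ω₀) S) ∧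
      ∀ S : ℝ≥0 → Wentzell.L2Sum Ω →L[ℂ] Wentzell.L2Sum Ω,
        Wentzell.Generates
          (Wentzell.subScalar (Wentzell.wentzellLaplacian Ω β) ω₀) S →
        Wentzell.IsLinftyContractive Ω S := by
  have : IsFiniteMeasure (Wentzell.surfOn Ω) := ⟨by simpa using hΓ⟩
  -- The smallest shift for which the pointwise bound |β| ≤ ω₀ holds almost everywhere on Γ.
  set ω₀ : ℝ := (eLpNorm β ∞ (Wentzell.surfOn Ω)).toReal with hω₀
  have hω : 0 ≤ ω₀ := ENNReal.toReal_nonneg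
  have hβω : ∀ᵐ x ∂(Wentzell.surfOn Ω), ‖β x‖ ≤ ω₀ := by
    rw [Wentzell.ae_norm_le_iff_eLpNorm_top_le hω, hω₀, ENNReal.ofReal_toReal hβ.2.ne]
  have hA := Wentzell.isMDissipative_zerothOrder hΩ hΩb hβ hω hβω
  refine ⟨ω₀, hω, ?_, ?_⟩
  · rw [Wentzell.subScalar_wentzellLaplacian_eq hΩ hΩb hβ]
    exact ⟨_, hA.generates⟩
  · intro S hS t _ p hp
    rw [Wentzell.subScalar_wentzellLaplacian_eq hΩ hΩb hβ] at hS
    have hM : 0 ≤ (Wentzell.linftyNorm Ω p).toReal := ENNReal.toReal_nonneg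
    have hiff : ∀ r, r ∈ Wentzell.linftyBall Ω (Wentzell.linftyNorm Ω p).toReal ↔
        Wentzell.linftyNorm Ω r ≤ Wentzell.linftyNorm Ω p := fun r => by
      rw [Wentzell.mem_linftyBall_iff hM, ENNReal.ofReal_toReal hp.ne]
    rw [← hiff]
    refine hA.mapsTo_of_resolvent hS (Wentzell.isClosed_linftyBall hM) (fun h hh f hf => ?_) t
      ((hiff p).2 le_rfl)
    exact Wentzell.mem_linftyBall_of_formRel hΩ hΩb hβ hω hβω hM hh hf (hA.resolvent_graph hh f)
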